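/- Let $A=(a_{jk})_{1\le j,k\le m}$ be the generator of a continuous-time Markov chain on $\{1,\dots,m\}$ ($a_{jk}\ge 0$ for $j\ne k$, zero row sums) which has a unique stationary distribution $\pi$ (i.e. $\pi$ is the only probability vector with $\pi A=0$; this holds for instance if the chain is irreducible), and let $\theta_1,\dots,\theta_m\ge 0$. Put $\bar\theta=\sum_{j=1}^m\theta_j\pi_j$. For every $x\ge 0$ let $N_x$ be the counting process of an $m$-state Markov modulated Poisson process with transition rates $r_{jk}=a_{jk}x$ and arrival rates $\theta_j$: there is a continuous-time Markov chain $J_x$ with generator $xA$, right-continuous paths and an arbitrary initial distribution (which may depend on $x$), such that, conditionally on the whole trajectory of $J_x$, the numbers of arrivals (requests) in disjoint intervals $(a,b]\subset[0,\infty)$ are independent and Poisson distributed with means $\int_a^b\theta_{J_x(u)}\,du$. As $x\to\infty$, the process becomes a Poisson process with rate $\bar\theta$, in the following sense. 1. For all $0\le t_0\le t_1\le\dots\le t_l$ and $n_1,\dots,n_l\in\mathbb N=\{0,1,2,\dots\}$, $$\mathbb P\bigl[N_x(t_i)-N_x(t_{i-1})=n_i,\ i=1,\dots,l\bigr]\longrightarrow\prod_{i=1}^l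 e^{-\bar\theta(t_i-t_{i-1})}\frac{(\bar\theta(t_i-t_{i-1}))^{n_i}}{n_i!}.$$ 2. Suppose $\bar\theta>0$. Then for every $x>0$ there are almost surely infinitely many arrivals. Let $X_{x,k}$ ($k\ge1$) be the time between the $(k-1)$-th and the $k$-th arrival of $N_x$, time $0$ counting as the $0$-th arrival. As $x\to\infty$, the sequence $(X_{x,k})_{k\ge1}$ converges in distribution (in $\mathbb R^{\mathbb N}$ with the product topology) to a sequence of independent exponential random variables with rate $\bar\theta$; in particular, each inter-request time is asymptotically exponential with rate $\bar\theta$. -/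

import Mathlib

open MeasureTheory ProbabilityTheory Filter Topology
open scoped NNReal

noncomputable section

/-- `Q` is the generator (rate matrix) of a continuous-time Markov chain on `Fin m`. -/
structure IsGenerator {m : ℕ} (Q : Matrix (Fin m) (Fin m) ℝ) : Prop where
  nonneg : ∀ j k, j ≠ k → 0 ≤ Q j k
  row_sum : ∀ j, ∑ k, Q j k = 0

/-- `p` is a stationary distribution of the chain with generator `Q`: a probability vector with
`p Q = 0`. -/
structure IsStationaryDist {m : ℕ} (Q : Matrix (Fin m) (Fin m) ℝ) (p : Fin m → ℝ) : Prop where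
  nonneg : ∀ j, 0 ≤ p j
  sum_eq_one : ∑ j, p j = 1
  vecMul_eq_zero : Matrix.vecMul p Q = 0

/-- `J` is a continuous-time Markov chain with generator `Q` under `P`: it has right-continuous
paths, and its finite-dimensional distributions are those of a Markov process with
transition matrices `exp (h Q)`, `h ≥ 0`. The initial distribution is arbitrary. -/
structure IsCTMC {m : ℕ} {Ω : Type*} [MeasurableSpace Ω] (Q : Matrix (Fin m) (Fin m) ℝ)
    (P : Measure Ω) (J : ℝ≥0 → Ω → Fin m) : Prop where
  measurable : ∀ t, Measurable (J t)
  rightCont : ∀ ω t, ContinuousWithinAt (fun s => J s ω) (Set.Ici t) t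
  markov : ∀ (l : ℕ) (t : Fin (l + 1) → ℝ≥0), Monotone t → ∀ j : Fin (l + 1) → Fin m,
    P.real {ω | ∀ i, J (t i) ω = j i} =
      P.real {ω | J (t 0) ω = j 0} *
        ∏ i : Fin l, NormedSpace.exp (((t i.succ : ℝ) - (t i.castSucc : ℝ)) • Q)
          (j i.castSucc) (j i.succ)

/-- The mass that the Poisson distribution with mean `r` gives to `n`. -/
def poissonMass (r : ℝ) (n : ℕ) : ℝ := Real.exp (-r) * r ^ n / (n.factorial : ℝ)

/-- The σ-algebra generated by the whole trajectory of `J`. -/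
abbrev pathSigma {m : ℕ} {Ω : Type*} (J : ℝ≥0 → Ω → Fin m) : MeasurableSpace Ω :=
  ⨆ t, MeasurableSpace.comap (J t) inferInstance

/-- The accumulated intensity `∫ θ_{J(u)} du` over the time interval `(a, b]`. -/
def cumIntensity {m : ℕ} {Ω : Type*} (θ : Fin m → ℝ) (J : ℝ≥0 → Ω → Fin m) (a b : ℝ≥0)
    (ω : Ω) : ℝ :=
  ∫ u in (a : ℝ)..(b : ℝ), θ (J u.toNNReal ω)

/-- `N` (with `N t` the number of arrivals in `(0, t]`) is the counting process of a Markov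
modulated Poisson process with generator `Q`, arrival rate `θ j` in state `j`, and modulating
chain `J`: `J` is a continuous-time Markov chain with generator `Q`, and, conditionally on the
whole trajectory of `J`, the numbers of arrivals in disjoint intervals `(a, b]` are independent
and Poisson distributed with means `∫_a^b θ_{J(u)} du`. -/
structure IsMMPP {m : ℕ} {Ω : Type*} [MeasurableSpace Ω] (Q : Matrix (Fin m) (Fin m) ℝ)
    (θ : Fin m → ℝ) (P : Measure Ω) (J : ℝ≥0 → Ω → Fin m) (N : ℝ≥0 → Ω → ℕ) : Prop where
  ctmc : IsCTMC Q P J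
  measurable : ∀ t, Measurable (N t)
  zero : ∀ ω, N 0 ω = 0
  mono : ∀ ω, Monotone fun t => N t ω
  rightCont : ∀ ω t, ContinuousWithinAt (fun s => N s ω) (Set.Ici t) t
  condPoisson : ∀ (l : ℕ) (t : Fin (l + 1) → ℝ≥0), Monotone t → ∀ n : Fin l → ℕ,
    P⟦{ω | ∀ i : Fin l, N (t i.succ) ω = N (t i.castSucc) ω + n i} | pathSigma J⟧ =ᵐ[P]
      fun ω => ∏ i : Fin l, poissonMass (cumIntensity θ J (t i.castSucc) (t i.succ) ω) (n i)

/-- The time of the `k`-th arrival (`0` for `k = 0`); it is meaningful if there are at least `k`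
arrivals. -/
def arrivalTime {Ω : Type*} (N : ℝ≥0 → Ω → ℕ) (k : ℕ) (ω : Ω) : ℝ :=
  ((sInf {t : ℝ≥0 | k ≤ N t ω} : ℝ≥0) : ℝ)

/-- The time between the `k`-th and the `(k + 1)`-th arrival, `k = 0, 1, 2, …`, where time `0`
counts as the `0`-th arrival. -/
def interRequestTime {Ω : Type*} (N : ℝ≥0 → Ω → ℕ) (k : ℕ) (ω : Ω) : ℝ :=
  arrivalTime N (k + 1) ω - arrivalTime N k ω

end

/-! Given the path of $J_x$, the increments of $N_x$ are independent Poisson variables with random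
means $\int\theta_{J_x}$, so the probability of prescribed increments is the expectation of a
product of Poisson masses. These masses are 1-Lipschitz in the mean, so part 1 reduces to
$\int_a^b\theta_{J_x}\to\bar\theta(b-a)$ in $L^2$. Uniqueness of $\pi$ makes the left kernel of $A$
one-dimensional, hence the Poisson equation $Ah=\theta-\bar\theta$ is solvable, and Dynkin's formula
for $xA$ bounds the mean-square error by $O(1/x)$ (`IsCTMC.integral_sq_cumIntensity_sub_le`). The
bound is uniform in the initial distribution and uses no convergence to equilibrium.

For part 2, the event that successive arrival times lie in intervals ordered one after the other is,
almost surely, a difference of two increment events. Its probability therefore converges, and the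
limit is the probability that partial sums of i.i.d. exponentials lie in the same intervals
(`tendsto_measureReal_arrivalTime_mem_Ioc`, `infinitePi_expMeasure_partialSum_mem_Ioc`). Such boxes
form a π-system with arbitrarily small neighbourhoods of every strictly increasing positive
sequence, hence of almost every point of the limit law. This yields weak convergence of the arrival
times, and taking successive differences is continuous. -/

/-! ### Invariant vectors and the Poisson equation. -/

/-- The positive part of a signed invariant vector of a generator is invariant. -/
theorem IsGenerator.vecMul_posPart_eq_zero {m : ℕ} {A : Matrix (Fin m) (Fin m) ℝ}
    (hA : IsGenerator A) {q : Fin m → ℝ} (hq : Matrix.vecMul q A = 0) :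
    Matrix.vecMul (fun j => max (q j) 0) A = 0 := by
  -- Only the diagonal entry of `A` can be negative. Its coefficient vanishes in the positive part
  -- when `q k ≤ 0`, and in the negative part when `q k > 0`; in the latter case invariance of `q`
  -- lets the negative part replace the positive one.
  have hnn : ∀ k, 0 ≤ Matrix.vecMul (fun j => max (q j) 0) A k := by
    intro k
    rcases le_or_gt (q k) 0 with hk | hk
    · change 0 ≤ ∑ j, max (q j) 0 * A j k
      refine Finset.sum_nonneg fun j _ => ?_
      rcases eq_or_ne j k with rfl | hjk
      · simp [hk]
      · exact mul_nonneg (le_max_right _ _) (hA.nonneg j k hjk)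
    · have h0 : ∑ j, q j * A j k = 0 := congrFun hq k
      have : Matrix.vecMul (fun j => max (q j) 0) A k
          = ∑ j, (max (q j) 0 - q j) * A j k := by
        simp only [sub_mul, Finset.sum_sub_distrib, h0, sub_zero]
        rfl
      rw [this]
      refine Finset.sum_nonneg fun j _ => ?_
      rcases eq_or_ne j k with rfl | hjk
      · simp [hk.le]
      · exact mul_nonneg (by simp) (hA.nonneg j k hjk)
  -- Zero row sums make the total vanish, so the nonnegative entries all vanish.
  have hsum : ∑ k, Matrix.vecMul (fun j => max (q j) 0) A k = 0 := by
    simp only [Matrix.vecMul, dotProduct]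
    rw [Finset.sum_comm]
    simp [← Finset.mul_sum, hA.row_sum]
  funext k
  exact (Finset.sum_eq_zero_iff_of_nonneg fun k _ => hnn k).1 hsum k (Finset.mem_univ k)

theorem nonneg_invariant_eq_smul {m : ℕ} {A : Matrix (Fin m) (Fin m) ℝ}
    {p : Fin m → ℝ} (hp_unique : ∀ q, IsStationaryDist A q → q = p)
    {q : Fin m → ℝ} (hq0 : ∀ j, 0 ≤ q j) (hq : Matrix.vecMul q A = 0) :
    q = (∑ j, q j) • p := by
  rcases (Finset.sum_nonneg fun j _ => hq0 j : 0 ≤ ∑ j, q j).eq_or_lt with hs | hs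
  · rw [← hs, zero_smul]
    funext j
    exact (Finset.sum_eq_zero_iff_of_nonneg fun k _ => hq0 k).1 hs.symm j (Finset.mem_univ j)
  · have : (∑ j, q j)⁻¹ • q = p := by
      refine hp_unique _ ⟨fun j => mul_nonneg (inv_nonneg.2 hs.le) (hq0 j), ?_, ?_⟩
      · simp only [Pi.smul_apply, smul_eq_mul, ← Finset.mul_sum]
        exact inv_mul_cancel₀ hs.ne'
      · rw [Matrix.smul_vecMul, hq, smul_zero]
    rw [← this, smul_smul, mul_inv_cancel₀ hs.ne', one_smul]

/-- Uniqueness of the stationary distribution makes the left kernel one-dimensional. -/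
theorem IsGenerator.exists_eq_smul_of_vecMul_eq_zero {m : ℕ} {A : Matrix (Fin m) (Fin m) ℝ}
    (hA : IsGenerator A) {p : Fin m → ℝ} (hp_unique : ∀ q, IsStationaryDist A q → q = p)
    {q : Fin m → ℝ} (hq : Matrix.vecMul q A = 0) : ∃ c : ℝ, q = c • p := by
  have h1 := nonneg_invariant_eq_smul hp_unique (fun j => le_max_right (q j) 0)
    (hA.vecMul_posPart_eq_zero hq)
  have hq' : Matrix.vecMul (-q) A = 0 := by rw [Matrix.neg_vecMul, hq, neg_zero]
  have h2 := nonneg_invariant_eq_smul hp_unique (fun j => le_max_right ((-q) j) 0)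
    (hA.vecMul_posPart_eq_zero hq')
  refine ⟨(∑ j, max (q j) 0) - ∑ j, max ((-q) j) 0, ?_⟩
  rw [sub_smul, ← h1, ← h2]
  funext j
  have := max_zero_sub_eq_self (q j)
  simp [this]

/-- Solvability of the Poisson equation `A h = g` for `g` of stationary mean zero. -/
theorem IsGenerator.exists_mulVec_eq {m : ℕ} {A : Matrix (Fin m) (Fin m) ℝ}
    (hA : IsGenerator A) {p : Fin m → ℝ} (hp_unique : ∀ q, IsStationaryDist A q → q = p)
    {g : Fin m → ℝ} (hg : ∑ j, p j * g j = 0) : ∃ h, A.mulVec h = g := by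
  by_contra hcon
  have hmem : g ∉ LinearMap.range A.mulVecLin := by
    rintro ⟨h, hh⟩
    exact hcon ⟨h, hh⟩
  -- Fredholm alternative: a functional separating `g` from the range is a left kernel vector, hence
  -- a multiple of `p`, and so it kills `g` after all.
  obtain ⟨f, hfg, hf⟩ := Submodule.exists_dual_map_eq_bot_of_notMem hmem inferInstance
  set q : Fin m → ℝ := fun j => f (Pi.single j 1) with hqdef
  have hfq : ∀ v, f v = ∑ j, q j * v j := by
    intro v
    conv_lhs => rw [pi_eq_sum_univ' v]
    simp only [map_sum, map_smul, smul_eq_mul, hqdef]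
    refine Finset.sum_congr rfl fun j _ => ?_
    rw [mul_comm]
  have hqA : Matrix.vecMul q A = 0 := by
    funext k
    have : f (A.mulVecLin (Pi.single k 1)) = 0 := by
      have : f (A.mulVecLin (Pi.single k 1)) ∈ (LinearMap.range A.mulVecLin).map f :=
        ⟨_, ⟨_, rfl⟩, rfl⟩
      rwa [hf, Submodule.mem_bot] at this
    rw [hfq] at this
    simpa [Matrix.vecMul, dotProduct, Matrix.mulVec_single] using this
  obtain ⟨c, hc⟩ := hA.exists_eq_smul_of_vecMul_eq_zero hp_unique hqA
  apply hfg
  rw [hfq, hc]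
  simp only [Pi.smul_apply, smul_eq_mul, mul_assoc, ← Finset.mul_sum, hg, mul_zero]

/-! ### Two-time expectations and joint measurability of the chain. -/

section CTMC

variable {m : ℕ} {Ω : Type*} [MeasurableSpace Ω] {Q : Matrix (Fin m) (Fin m) ℝ}
  {P : Measure Ω} {J : ℝ≥0 → Ω → Fin m}

theorem IsCTMC.measureReal_pair (hJ : IsCTMC Q P J) {u v : ℝ≥0} (huv : u ≤ v) (j k : Fin m) :
    P.real {ω | J u ω = j ∧ J v ω = k}
      = P.real {ω | J u ω = j} * NormedSpace.exp (((v : ℝ) - u) • Q) j k := by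
  have hmono : Monotone ![u, v] := by
    rw [Fin.monotone_iff_le_succ]
    intro i
    fin_cases i
    simpa using huv
  simpa [Fin.forall_fin_two] using hJ.markov 1 ![u, v] hmono ![j, k]

theorem IsCTMC.integral_mul [IsProbabilityMeasure P] (hJ : IsCTMC Q P J) {u v : ℝ≥0} (huv : u ≤ v)
    (g f : Fin m → ℝ) :
    ∫ ω, g (J u ω) * f (J v ω) ∂P = (fun j => P.real {ω | J u ω = j} * g j) ⬝ᵥ
      (NormedSpace.exp (((v : ℝ) - u) • Q)).mulVec f := by
  have hmeas : Measurable fun ω => (J u ω, J v ω) := (hJ.measurable u).prodMk (hJ.measurable v)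
  have h1 : ∫ ω, g (J u ω) * f (J v ω) ∂P
      = ∫ z : Fin m × Fin m, g z.1 * f z.2 ∂(P.map fun ω => (J u ω, J v ω)) :=
    (integral_map hmeas.aemeasurable
      (f := fun z : Fin m × Fin m => g z.1 * f z.2)
      (measurable_of_countable _).aestronglyMeasurable).symm
  have : IsProbabilityMeasure (P.map fun ω => (J u ω, J v ω)) :=
    Measure.isProbabilityMeasure_map hmeas.aemeasurable
  rw [h1, integral_fintype (Integrable.of_finite), Fintype.sum_prod_type]
  simp only [dotProduct, Matrix.mulVec, Finset.mul_sum]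
  refine Finset.sum_congr rfl fun j _ => Finset.sum_congr rfl fun k _ => ?_
  have h2 : (P.map fun ω => (J u ω, J v ω)).real {(j, k)}
      = P.real {ω | J u ω = j} * NormedSpace.exp (((v : ℝ) - u) • Q) j k := by
    rw [← hJ.measureReal_pair huv j k, map_measureReal_apply hmeas (measurableSet_singleton _)]
    congr 1
    ext ω
    simp
  rw [h2, smul_eq_mul]
  ring

-- Kolmogorov's forward equation, paired with a row and a column vector. The matrix norm serves only
-- to differentiate the exponential.
attribute [local instance] Matrix.linftyOpNormedRing Matrix.linftyOpNormedAlgebra in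
theorem hasDerivAt_dotProduct_exp_mulVec (Q : Matrix (Fin m) (Fin m) ℝ) (w h : Fin m → ℝ) (u v : ℝ) :
    HasDerivAt (fun v : ℝ => w ⬝ᵥ (NormedSpace.exp ((v - u) • Q)).mulVec h)
      (w ⬝ᵥ (NormedSpace.exp ((v - u) • Q)).mulVec (Q.mulVec h)) v := by
  have h1 := (hasDerivAt_exp_smul_const (𝕂 := ℝ) Q (v - u)).comp_sub_const v u
  let L : Matrix (Fin m) (Fin m) ℝ →ₗ[ℝ] ℝ :=
    { toFun := fun M => w ⬝ᵥ M.mulVec h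
      map_add' := fun M M' => by rw [Matrix.add_mulVec, dotProduct_add]
      map_smul' := fun c M => by rw [Matrix.smul_mulVec, dotProduct_smul]; rfl }
  have h2 := (LinearMap.toContinuousLinearMap L).hasFDerivAt.comp_hasDerivAt v h1
  rw [Matrix.mulVec_mulVec]
  exact h2

/-- Dynkin's formula for `h`, weighted by a function of the state at the starting time `u`. -/
theorem IsCTMC.integral_integral_mul [IsProbabilityMeasure P] (hJ : IsCTMC Q P J)
    {u b : ℝ} (hu : 0 ≤ u) (hub : u ≤ b) (g h : Fin m → ℝ) :
    ∫ v in u..b, ∫ ω, g (J u.toNNReal ω) * Q.mulVec h (J v.toNNReal ω) ∂P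
      = ∫ ω, g (J u.toNNReal ω) * h (J b.toNNReal ω) ∂P
        - ∫ ω, g (J u.toNNReal ω) * h (J u.toNNReal ω) ∂P := by
  set w : Fin m → ℝ := fun j => P.real {ω | J u.toNNReal ω = j} * g j
  have key : ∀ f : Fin m → ℝ, ∀ v, u ≤ v → ∫ ω, g (J u.toNNReal ω) * f (J v.toNNReal ω) ∂P
      = w ⬝ᵥ (NormedSpace.exp ((v - u) • Q)).mulVec f := by
    intro f v huv
    rw [hJ.integral_mul (Real.toNNReal_le_toNNReal huv), Real.coe_toNNReal _ hu,
      Real.coe_toNNReal _ (hu.trans huv)]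
  rw [key h b hub, key h u le_rfl]
  have : ∫ v in u..b, ∫ ω, g (J u.toNNReal ω) * Q.mulVec h (J v.toNNReal ω) ∂P
      = ∫ v in u..b, w ⬝ᵥ (NormedSpace.exp ((v - u) • Q)).mulVec (Q.mulVec h) := by
    refine intervalIntegral.integral_congr fun v hv => ?_
    rw [Set.uIcc_of_le hub] at hv
    exact key _ v hv.1
  rw [this]
  refine intervalIntegral.integral_eq_sub_of_hasDerivAt
    (fun v _ => hasDerivAt_dotProduct_exp_mulVec Q w h u v) ?_
  refine Continuous.intervalIntegrable ?_ _ _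
  exact continuous_iff_continuousAt.2 fun v =>
    (hasDerivAt_dotProduct_exp_mulVec Q w (Q.mulVec h) u v).continuousAt

theorem tendsto_comp_of_continuousWithinAt_Ici {β : Type*} [TopologicalSpace β] {F : ℝ≥0 → β}
    {t : ℝ≥0} (hF : ContinuousWithinAt F (Set.Ici t) t) {s : ℕ → ℝ≥0} (hs : ∀ n, t ≤ s n)
    (hst : Tendsto s atTop (𝓝 t)) : Tendsto (fun n => F (s n)) atTop (𝓝 (F t)) :=
  hF.tendsto.comp (tendsto_nhdsWithin_iff.2 ⟨hst, Eventually.of_forall hs⟩)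

/-- A right-continuous family of measurable maps is jointly measurable after composition with a
real function on the (finite) state space. -/
theorem IsCTMC.measurable_uncurry (hJ : IsCTMC Q P J) (g : Fin m → ℝ) :
    Measurable fun q : ℝ × Ω => g (J q.1.toNNReal q.2) := by
  have hcomp : ∀ (c : ℕ → ℝ≥0) (φ : ℝ → ℕ), Measurable φ →
      Measurable fun q : ℝ × Ω => g (J (c (φ q.1)) q.2) := by
    intro c φ hφ
    have h1 : Measurable fun z : ℕ × Ω => g (J (c z.1) z.2) :=
      measurable_from_prod_countable_right fun i =>
        (measurable_of_countable g).comp (hJ.measurable (c i))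
    exact h1.comp ((hφ.comp measurable_fst).prodMk measurable_snd)
  -- The time is rounded up to a grid: countably many times give measurability, and approaching from
  -- the right is what right-continuity can handle.
  have happrox : ∀ n : ℕ, Measurable fun q : ℝ × Ω =>
      g (J (((⌊q.1.toNNReal * (n + 1 : ℝ≥0)⌋₊ : ℝ≥0) + 1) / (n + 1)) q.2) := fun n =>
    hcomp (fun i => ((i : ℝ≥0) + 1) / (n + 1)) (fun x => ⌊x.toNNReal * (n + 1 : ℝ≥0)⌋₊)
      (Nat.measurable_floor.comp (measurable_real_toNNReal.mul_const _))
  refine measurable_of_tendsto_metrizable happrox (tendsto_pi_nhds.2 fun q => ?_)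
  set t := q.1.toNNReal
  have hcont : ContinuousWithinAt (fun s => g (J s q.2)) (Set.Ici t) t :=
    (continuous_of_discreteTopology (f := g)).continuousAt.comp_continuousWithinAt
      (hJ.rightCont q.2 t)
  have hlow : ∀ n : ℕ, t ≤ ((⌊t * (n + 1 : ℝ≥0)⌋₊ : ℝ≥0) + 1) / (n + 1) := by
    intro n
    rw [le_div_iff₀ (by positivity)]
    exact (Nat.lt_floor_add_one _).le
  have hup : ∀ n : ℕ, ((⌊t * (n + 1 : ℝ≥0)⌋₊ : ℝ≥0) + 1) / (n + 1) ≤ t + 1 / (n + 1) := by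
    intro n
    rw [add_div]
    gcongr
    rw [div_le_iff₀ (by positivity)]
    exact Nat.floor_le zero_le
  have hlim : Tendsto (fun n : ℕ => t + 1 / ((n : ℝ≥0) + 1)) atTop (𝓝 t) := by
    have : Tendsto (fun n : ℕ => 1 / ((n : ℝ≥0) + 1)) atTop (𝓝 0) :=
      tendsto_one_div_add_atTop_nhds_zero_nat
    simpa using this.const_add t
  exact tendsto_comp_of_continuousWithinAt_Ici hcont hlow
    (tendsto_of_tendsto_of_tendsto_of_le_of_le tendsto_const_nhds hlim hlow hup)

end CTMC

/-! ### Mean-square deviation of the accumulated intensity. -/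

/-- By Fubini the second moment is the integral of the symmetric correlation `c` over a square. The
two triangles of the square contribute equally, whence the factor 2, and only correlations with
later times need to be controlled. -/
theorem integral_sq_intervalIntegral_le {Ω : Type*} [MeasurableSpace Ω] {P : Measure Ω}
    [IsProbabilityMeasure P] {G : ℝ × Ω → ℝ} (hG : Measurable G) {B : ℝ} (hB : ∀ z, |G z| ≤ B)
    {a b K : ℝ} (hab : a ≤ b)
    (hK : ∀ u, a < u → u ≤ b → |∫ v in u..b, ∫ ω, G (u, ω) * G (v, ω) ∂P| ≤ K) :
    ∫ ω, (∫ u in a..b, G (u, ω)) ^ 2 ∂P ≤ 2 * K * (b - a) := by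
  set ρ : Measure ℝ := volume.restrict (Set.Ioc a b) with hρ
  set c : ℝ × ℝ → ℝ := fun z => ∫ ω, G (z.1, ω) * G (z.2, ω) ∂P with hc
  have hFm : Measurable fun q : (ℝ × ℝ) × Ω => G (q.1.1, q.2) * G (q.1.2, q.2) := by fun_prop
  have hFi : Integrable (fun q : (ℝ × ℝ) × Ω => G (q.1.1, q.2) * G (q.1.2, q.2))
      ((ρ.prod ρ).prod P) := by
    refine Integrable.of_bound hFm.aestronglyMeasurable (B * B) (ae_of_all _ fun q => ?_)
    rw [norm_mul]
    exact mul_le_mul (hB _) (hB _) (norm_nonneg _) ((abs_nonneg _).trans (hB (q.1.1, q.2)))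
  have hci : Integrable c (ρ.prod ρ) := hFi.integral_prod_left
  have h1 : ∫ ω, (∫ u in a..b, G (u, ω)) ^ 2 ∂P = ∫ z, c z ∂(ρ.prod ρ) := by
    rw [← integral_prod _ hFi, integral_prod_symm _ hFi]
    refine integral_congr_ae (ae_of_all _ fun ω => ?_)
    simp only
    rw [intervalIntegral.integral_of_le hab, sq]
    exact (integral_prod_mul (fun u => G (u, ω)) fun v => G (v, ω)).symm
  have hsection : ∀ D : Set (ℝ × ℝ), MeasurableSet D →
      (∀ u, a < u → u ≤ b → ∫ v in Set.Ioc a b ∩ {v | (u, v) ∈ D}, c (u, v)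
        = ∫ v in u..b, c (u, v)) →
      ∫ z, D.indicator c z ∂(ρ.prod ρ) ≤ K * (b - a) := by
    intro D hD hsec
    rw [integral_prod _ (hci.indicator hD)]
    refine (le_abs_self _).trans ?_
    have hvol : (volume : Measure ℝ).real (Set.Ioc a b) = b - a := by
      simp [Measure.real, hab]
    rw [← hvol, ← Real.norm_eq_abs]
    refine norm_setIntegral_le_of_norm_le_const (μ := (volume : Measure ℝ))
      (s := Set.Ioc a b) measure_Ioc_lt_top fun u hu => ?_
    have hDu : MeasurableSet {v | (u, v) ∈ D} := measurable_prodMk_left hD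
    have : ∫ v, D.indicator c (u, v) ∂ρ = ∫ v in u..b, c (u, v) := by
      rw [← hsec u hu.1 hu.2, Set.inter_comm, ← Measure.restrict_restrict hDu,
        ← integral_indicator hDu]
      rfl
    rw [this]
    exact hK u hu.1 hu.2
  have hle : MeasurableSet {z : ℝ × ℝ | z.1 ≤ z.2} := measurableSet_le measurable_fst measurable_snd
  have hlt : MeasurableSet {z : ℝ × ℝ | z.1 < z.2} := measurableSet_lt measurable_fst measurable_snd
  have h2 : ∫ z, c z ∂(ρ.prod ρ) = ∫ z, {z : ℝ × ℝ | z.1 ≤ z.2}.indicator c z ∂(ρ.prod ρ)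
      + ∫ z, {z : ℝ × ℝ | z.1 < z.2}.indicator c z ∂(ρ.prod ρ) := by
    -- Reflection in the diagonal, with the diagonal itself kept in the other triangle.
    have hswap : ∫ z, {z : ℝ × ℝ | z.1 < z.2}.indicator c z ∂(ρ.prod ρ)
        = ∫ z, {z : ℝ × ℝ | z.1 ≤ z.2}ᶜ.indicator c z ∂(ρ.prod ρ) := by
      rw [← integral_prod_swap]
      refine integral_congr_ae (ae_of_all _ fun z => ?_)
      have : c z.swap = c z := integral_congr_ae (ae_of_all _ fun ω => mul_comm _ _)
      simp [Set.indicator_apply, this]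
    rw [hswap, ← integral_add (hci.indicator hle) (hci.indicator hle.compl)]
    refine integral_congr_ae (ae_of_all _ fun z => ?_)
    exact (congrFun (Set.indicator_self_add_compl _ c) z).symm
  rw [h1, h2]
  have h3 := hsection _ hle fun u hu hub => by
    have : Set.Ioc a b ∩ {v | (u, v) ∈ {z : ℝ × ℝ | z.1 ≤ z.2}} = Set.Icc u b := by
      ext v; simp only [Set.mem_inter_iff, Set.mem_Ioc, Set.mem_ofPred_eq, Set.mem_Icc]; grind
    rw [this, integral_Icc_eq_integral_Ioc, intervalIntegral.integral_of_le hub]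
  have h4 := hsection _ hlt fun u hu hub => by
    have : Set.Ioc a b ∩ {v | (u, v) ∈ {z : ℝ × ℝ | z.1 < z.2}} = Set.Ioc u b := by
      ext v; simp only [Set.mem_inter_iff, Set.mem_Ioc, Set.mem_ofPred_eq]; grind
    rw [this, intervalIntegral.integral_of_le hub]
  linarith

theorem cumIntensity_nonneg {m : ℕ} {Ω : Type*} {J : ℝ≥0 → Ω → Fin m} {θ : Fin m → ℝ} (hθ : ∀ j, 0 ≤ θ j)
    {a b : ℝ≥0} (hab : a ≤ b) (ω : Ω) :
    0 ≤ cumIntensity θ J a b ω :=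
  intervalIntegral.integral_nonneg (NNReal.coe_le_coe.2 hab) fun _ _ => hθ _

section

variable {m : ℕ} {Ω : Type*} [MeasurableSpace Ω] {P : Measure Ω} {J : ℝ≥0 → Ω → Fin m}

theorem IsCTMC.intervalIntegrable {Q : Matrix (Fin m) (Fin m) ℝ} (hJ : IsCTMC Q P J)
    (g : Fin m → ℝ) (a b : ℝ) (ω : Ω) :
    IntervalIntegrable (fun u => g (J u.toNNReal ω)) volume a b := by
  have hm : Measurable fun u : ℝ => g (J u.toNNReal ω) :=
    (hJ.measurable_uncurry g).comp (measurable_id.prodMk measurable_const)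
  rw [intervalIntegrable_iff]
  have : IsFiniteMeasure (volume.restrict (Set.uIoc a b)) := ⟨by simp [Set.uIoc]⟩
  exact Integrable.of_bound hm.aestronglyMeasurable (∑ j, ‖g j‖) (ae_of_all _ fun u =>
    Finset.single_le_sum (f := fun j => ‖g j‖) (fun j _ => norm_nonneg _) (Finset.mem_univ _))

theorem IsCTMC.measurable_cumIntensity {Q : Matrix (Fin m) (Fin m) ℝ} (hJ : IsCTMC Q P J)
    (θ : Fin m → ℝ) {a b : ℝ≥0} (hab : a ≤ b) : Measurable (cumIntensity θ J a b) := by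
  have h : StronglyMeasurable fun q : Ω × ℝ => θ (J q.2.toNNReal q.1) :=
    ((hJ.measurable_uncurry θ).comp measurable_swap).stronglyMeasurable
  have : cumIntensity θ J a b = fun ω => ∫ u in Set.Ioc (a : ℝ) b, θ (J u.toNNReal ω) := by
    funext ω
    exact intervalIntegral.integral_of_le (NNReal.coe_le_coe.2 hab)
  rw [this]
  exact (h.integral_prod_right (ν := volume.restrict (Set.Ioc (a : ℝ) b))).measurable

theorem IsCTMC.abs_cumIntensity_sub_le {Q : Matrix (Fin m) (Fin m) ℝ} (hJ : IsCTMC Q P J)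
    {θ : Fin m → ℝ} {c B : ℝ} (hB : ∀ j, |θ j - c| ≤ B) {a b : ℝ≥0} (hab : a ≤ b) (ω : Ω) :
    |cumIntensity θ J a b ω - c * ((b : ℝ) - a)| ≤ B * ((b : ℝ) - a) := by
  have hab' : (a : ℝ) ≤ b := NNReal.coe_le_coe.2 hab
  have h : cumIntensity θ J a b ω - c * ((b : ℝ) - a)
      = ∫ u in (a : ℝ)..b, (θ (J u.toNNReal ω) - c) := by
    rw [intervalIntegral.integral_sub (hJ.intervalIntegrable θ _ _ ω) (by simp)]
    simp [cumIntensity, mul_comm]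
  rw [h]
  have := intervalIntegral.norm_integral_le_of_norm_le_const (a := (a : ℝ)) (b := b) (C := B)
    (f := fun u => θ (J u.toNNReal ω) - c) fun u _ => hB (J u.toNNReal ω)
  simpa [abs_of_nonneg (sub_nonneg.2 hab')] using this

/-- The accumulated intensity of a chain sped up by the factor `x` deviates from its stationary
mean, in mean square, by at most a multiple of the length of the interval divided by `x`. -/
theorem IsCTMC.integral_sq_cumIntensity_sub_le [IsProbabilityMeasure P]
    {A : Matrix (Fin m) (Fin m) ℝ} {x : ℝ} (hx : 0 < x) (hJ : IsCTMC (x • A) P J)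
    {θ h : Fin m → ℝ} {c B H : ℝ} (hh : A.mulVec h = fun j => θ j - c)
    (hB : ∀ j, |θ j - c| ≤ B) (hH : ∀ j, |h j| ≤ H) {a b : ℝ≥0} (hab : a ≤ b) :
    ∫ ω, (cumIntensity θ J a b ω - c * ((b : ℝ) - a)) ^ 2 ∂P
      ≤ 4 * B * H / x * ((b : ℝ) - a) := by
  have hab' : (a : ℝ) ≤ b := NNReal.coe_le_coe.2 hab
  set g : Fin m → ℝ := fun j => θ j - c with hg
  have h1 : ∀ ω, cumIntensity θ J a b ω - c * ((b : ℝ) - a)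
      = ∫ u in (a : ℝ)..b, g (J u.toNNReal ω) := by
    intro ω
    simp only [hg]
    rw [intervalIntegral.integral_sub (hJ.intervalIntegrable θ _ _ ω) (by simp)]
    simp [cumIntensity, mul_comm]
  simp only [h1]
  have hbound : ∀ u v : ℝ, |∫ ω, g (J u.toNNReal ω) * h (J v.toNNReal ω) ∂P| ≤ B * H := by
    intro u v
    have := norm_integral_le_of_norm_le_const (μ := P) (C := B * H)
      (f := fun ω => g (J u.toNNReal ω) * h (J v.toNNReal ω)) (ae_of_all _ fun ω => by
        rw [norm_mul]
        exact mul_le_mul (hB _) (hH _) (norm_nonneg _) ((abs_nonneg _).trans (hB (J 0 ω))))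
    simpa using this
  -- Dynkin's formula for `x • A` gives `x` times the correlation integral as a difference of two
  -- terms bounded by `B * H`; hence this `K`.
  refine (integral_sq_intervalIntegral_le (G := fun q => g (J q.1.toNNReal q.2)) (B := B)
    (K := 2 * B * H / x) (hJ.measurable_uncurry g) (fun _ => hB _) hab' ?_).trans_eq (by ring)
  intro u hau hub
  have h2 := hJ.integral_integral_mul (a.coe_nonneg.trans hau.le) hub g h
  have h3 : (x • A).mulVec h = fun j => x * g j := by
    rw [Matrix.smul_mulVec, hh]; rfl
  rw [h3] at h2
  have h4 : ∫ v in u..b, ∫ ω, g (J u.toNNReal ω) * (fun j => x * g j) (J v.toNNReal ω) ∂P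
      = x * ∫ v in u..b, ∫ ω, g (J u.toNNReal ω) * g (J v.toNNReal ω) ∂P := by
    rw [← intervalIntegral.integral_const_mul]
    refine intervalIntegral.integral_congr fun v _ => ?_
    simp only
    rw [← integral_const_mul]
    exact integral_congr_ae (ae_of_all _ fun ω => by ring)
  rw [h4] at h2
  change |∫ v in u..b, ∫ ω, g (J u.toNNReal ω) * g (J v.toNNReal ω) ∂P| ≤ _
  rw [le_div_iff₀ hx, ← abs_of_pos hx, ← abs_mul, mul_comm, h2]
  have := norm_sub_le (∫ ω, g (J u.toNNReal ω) * h (J (b : ℝ).toNNReal ω) ∂P)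
    (∫ ω, g (J u.toNNReal ω) * h (J u.toNNReal ω) ∂P)
  simp only [Real.norm_eq_abs] at this
  linarith [hbound u b, hbound u u]

end

/-! ### Estimates for Poisson masses. -/

theorem poissonMass_nonneg {r : ℝ} (hr : 0 ≤ r) (n : ℕ) : 0 ≤ poissonMass r n := by
  unfold poissonMass; positivity

theorem poissonMass_le_one {r : ℝ} (hr : 0 ≤ r) (n : ℕ) : poissonMass r n ≤ 1 := by
  rw [poissonMass, mul_div_assoc, Real.exp_neg, inv_mul_le_one₀ (Real.exp_pos r)]
  exact Real.pow_div_factorial_le_exp r hr n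

theorem mul_poissonMass (r : ℝ) (n : ℕ) :
    r * poissonMass r n = (n + 1) * poissonMass r (n + 1) := by
  simp only [poissonMass, Nat.factorial_succ, Nat.cast_mul, pow_succ]
  push_cast
  field_simp

/-- A crude decay as the mean grows; it suffices to show that the count does not stay bounded. -/
theorem poissonMass_le_div {r : ℝ} (hr : 0 < r) (n : ℕ) : poissonMass r n ≤ (n + 1) / r := by
  rw [le_div_iff₀ hr, mul_comm, mul_poissonMass]
  exact mul_le_of_le_one_right (by positivity) (poissonMass_le_one hr.le _)

theorem continuous_poissonMass (n : ℕ) : Continuous fun r => poissonMass r n := by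
  unfold poissonMass; fun_prop

theorem hasDerivAt_poissonMass_zero (r : ℝ) :
    HasDerivAt (fun r => poissonMass r 0) (-poissonMass r 0) r := by
  simpa [poissonMass] using (hasDerivAt_neg r).exp

theorem hasDerivAt_poissonMass_succ (n : ℕ) (r : ℝ) :
    HasDerivAt (fun r => poissonMass r (n + 1)) (poissonMass r n - poissonMass r (n + 1)) r := by
  have h := ((hasDerivAt_neg r).exp.mul (hasDerivAt_pow (n + 1) r)).div_const
    ((n + 1).factorial : ℝ)
  refine h.congr_deriv ?_
  simp only [poissonMass, Nat.factorial_succ]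
  push_cast
  field_simp
  ring

/-- The derivative in the mean is a difference of two numbers in `[0, 1]` (or minus one such
number), so the mean value inequality applies with constant 1. -/
theorem abs_poissonMass_sub_le {r s : ℝ} (hr : 0 ≤ r) (hs : 0 ≤ s) (n : ℕ) :
    |poissonMass r n - poissonMass s n| ≤ |r - s| := by
  have key : ∀ f' : ℝ → ℝ, (∀ x, HasDerivAt (fun r => poissonMass r n) (f' x) x) →
      (∀ x, 0 ≤ x → |f' x| ≤ 1) → |poissonMass r n - poissonMass s n| ≤ |r - s| := by
    intro f' hf hf'
    have := (convex_Ici (0 : ℝ)).norm_image_sub_le_of_norm_hasDerivWithin_le (C := 1)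
      (fun x _ => (hf x).hasDerivWithinAt) (fun x hx => hf' x hx) hs hr
    simpa using this
  cases n with
  | zero =>
    refine key _ hasDerivAt_poissonMass_zero fun x hx => ?_
    rw [abs_neg, abs_of_nonneg (poissonMass_nonneg hx 0)]
    exact poissonMass_le_one hx 0
  | succ n =>
    refine key _ (hasDerivAt_poissonMass_succ n) fun x hx => abs_sub_le_iff.2 ⟨?_, ?_⟩ <;>
    linarith [poissonMass_nonneg hx n, poissonMass_nonneg hx (n + 1), poissonMass_le_one hx n,
      poissonMass_le_one hx (n + 1)]

theorem abs_prod_sub_prod_le {ι : Type*} (s : Finset ι) {f g : ι → ℝ} (hf : ∀ i, |f i| ≤ 1)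
    (hg : ∀ i, |g i| ≤ 1) : |∏ i ∈ s, f i - ∏ i ∈ s, g i| ≤ ∑ i ∈ s, |f i - g i| := by
  classical
  induction s using Finset.induction_on with
  | empty => simp
  | insert a s ha ih =>
    rw [Finset.prod_insert ha, Finset.prod_insert ha, Finset.sum_insert ha]
    have h1 : f a * ∏ i ∈ s, f i - g a * ∏ i ∈ s, g i
        = (f a - g a) * ∏ i ∈ s, f i + g a * (∏ i ∈ s, f i - ∏ i ∈ s, g i) := by ring
    have h2 : |∏ i ∈ s, f i| ≤ 1 := by
      rw [Finset.abs_prod]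
      exact Finset.prod_le_one (fun i _ => abs_nonneg _) fun i _ => hf i
    rw [h1]
    refine (abs_add_le _ _).trans (add_le_add ?_ ?_)
    · rw [abs_mul]
      exact mul_le_of_le_one_right (abs_nonneg _) h2
    · rw [abs_mul]
      exact (mul_le_of_le_one_left (abs_nonneg _) (hg a)).trans ih

/-- This is nonnegativity of the variance of `|D|`. -/
theorem integral_abs_le_sqrt {Ω : Type*} [MeasurableSpace Ω] {P : Measure Ω}
    [IsProbabilityMeasure P] {D : Ω → ℝ} (hD : MemLp D 2 P) :
    ∫ ω, |D ω| ∂P ≤ √(∫ ω, D ω ^ 2 ∂P) := by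
  refine Real.le_sqrt_of_sq_le ?_
  have h := variance_nonneg |D| P
  rw [variance_eq_sub hD.abs] at h
  simp only [Pi.pow_apply, Pi.abs_apply, sq_abs] at h
  linarith

/-! ### Mixed Poisson increments and infinitely many arrivals. -/

section

variable {m : ℕ} {Ω : Type*} [MeasurableSpace Ω] {P : Measure Ω} {J : ℝ≥0 → Ω → Fin m}
  {N : ℝ≥0 → Ω → ℕ}

theorem IsCTMC.memLp_cumIntensity_sub [IsProbabilityMeasure P]
    {Q : Matrix (Fin m) (Fin m) ℝ} (hJ : IsCTMC Q P J)
    (θ : Fin m → ℝ) (c : ℝ) {a b : ℝ≥0} (hab : a ≤ b) :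
    MemLp (fun ω => cumIntensity θ J a b ω - c * ((b : ℝ) - a)) 2 P :=
  MemLp.of_bound ((hJ.measurable_cumIntensity θ hab).sub_const _).aestronglyMeasurable _
    (ae_of_all _ fun ω => hJ.abs_cumIntensity_sub_le (B := ∑ j, |θ j - c|)
      (fun j => Finset.single_le_sum (f := fun j => |θ j - c|) (fun _ _ => abs_nonneg _)
        (Finset.mem_univ j)) hab ω)

theorem IsMMPP.measureReal_increments [IsProbabilityMeasure P] {Q : Matrix (Fin m) (Fin m) ℝ}
    {θ : Fin m → ℝ} (hN : IsMMPP Q θ P J N) {l : ℕ} {t : Fin (l + 1) → ℝ≥0} (ht : Monotone t)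
    (n : Fin l → ℕ) :
    P.real {ω | ∀ i : Fin l, N (t i.succ) ω = N (t i.castSucc) ω + n i}
      = ∫ ω, ∏ i : Fin l, poissonMass (cumIntensity θ J (t i.castSucc) (t i.succ) ω) (n i) ∂P := by
  have hle : pathSigma J ≤ ‹MeasurableSpace Ω› :=
    iSup_le fun s => (hN.ctmc.measurable s).comap_le
  have hmeas : MeasurableSet {ω | ∀ i : Fin l, N (t i.succ) ω = N (t i.castSucc) ω + n i} := by
    simp only [Set.ofPred_forall]
    exact MeasurableSet.iInter fun i =>
      measurableSet_eq_fun (hN.measurable _) ((hN.measurable _).add_const _)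
  rw [← integral_congr_ae (hN.condPoisson l t ht n), integral_condExp hle,
    integral_indicator_const _ hmeas, smul_eq_mul, mul_one]

/-- Products of numbers in `[0, 1]` differ by at most the sum of the differences of their factors;
the Lipschitz bound and the passage from $L^1$ to $L^2$ finish. -/
theorem abs_integral_prod_poissonMass_sub_le [IsProbabilityMeasure P] {ι : Type*} (s : Finset ι)
    {L : ι → Ω → ℝ} {r : ι → ℝ} (hL : ∀ i ω, 0 ≤ L i ω) (hr : ∀ i, 0 ≤ r i)
    (hLr : ∀ i, MemLp (fun ω => L i ω - r i) 2 P) (n : ι → ℕ) :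
    |∫ ω, ∏ i ∈ s, poissonMass (L i ω) (n i) ∂P - ∏ i ∈ s, poissonMass (r i) (n i)|
      ≤ ∑ i ∈ s, √(∫ ω, (L i ω - r i) ^ 2 ∂P) := by
  have hpm : ∀ {x : ℝ}, 0 ≤ x → ∀ k, |poissonMass x k| ≤ 1 := fun hx k => by
    rw [abs_of_nonneg (poissonMass_nonneg hx k)]
    exact poissonMass_le_one hx k
  have hLm : ∀ i, AEStronglyMeasurable (L i) P := fun i => by
    simpa using (hLr i).aestronglyMeasurable.add_const (r i)
  have hint : Integrable (fun ω => ∏ i ∈ s, poissonMass (L i ω) (n i)) P := by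
    refine Integrable.of_bound (Finset.aestronglyMeasurable_fun_prod s fun i _ =>
      (continuous_poissonMass (n i)).comp_aestronglyMeasurable (hLm i)) 1 (ae_of_all _ fun ω => ?_)
    rw [Real.norm_eq_abs, Finset.abs_prod]
    exact Finset.prod_le_one (fun i _ => abs_nonneg _) fun i _ => hpm (hL i ω) _
  have h1 : ∫ ω, ∏ i ∈ s, poissonMass (L i ω) (n i) ∂P - ∏ i ∈ s, poissonMass (r i) (n i)
      = ∫ ω, (∏ i ∈ s, poissonMass (L i ω) (n i) - ∏ i ∈ s, poissonMass (r i) (n i)) ∂P := by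
    rw [integral_sub hint (integrable_const _)]
    simp
  have habs : ∀ i, Integrable (fun ω => |L i ω - r i|) P := fun i =>
    ((hLr i).integrable (by norm_num)).abs
  rw [h1]
  calc _ ≤ ∫ ω, |∏ i ∈ s, poissonMass (L i ω) (n i) - ∏ i ∈ s, poissonMass (r i) (n i)| ∂P :=
        abs_integral_le_integral_abs
    _ ≤ ∫ ω, ∑ i ∈ s, |L i ω - r i| ∂P := by
        refine integral_mono (hint.sub (integrable_const _)).abs
          (integrable_finsetSum _ fun i _ => habs i) fun ω => ?_
        refine (abs_prod_sub_prod_le s (fun i => hpm (hL i ω) _) fun i => hpm (hr i) _).trans ?_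
        exact Finset.sum_le_sum fun i _ => abs_poissonMass_sub_le (hL i ω) (hr i) _
    _ = ∑ i ∈ s, ∫ ω, |L i ω - r i| ∂P := integral_finsetSum _ fun i _ => habs i
    _ ≤ _ := Finset.sum_le_sum fun i _ => integral_abs_le_sqrt (hLr i)

/-- If the accumulated intensity grows linearly in mean square, then infinitely many arrivals
occur almost surely. -/
theorem IsMMPP.ae_forall_exists_le [IsProbabilityMeasure P] {Q : Matrix (Fin m) (Fin m) ℝ}
    {θ : Fin m → ℝ} (hθ : ∀ j, 0 ≤ θ j) (hN : IsMMPP Q θ P J N) {r C : ℝ} (hr : 0 < r)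
    (hC : ∀ t : ℝ≥0, ∫ ω, (cumIntensity θ J 0 t ω - r * t) ^ 2 ∂P ≤ C * t) :
    ∀ᵐ ω ∂P, ∀ k : ℕ, ∃ t : ℝ≥0, k ≤ N t ω := by
  have hlim0 : ∀ K : ℝ, Tendsto (fun t : ℕ => K / (t : ℝ)) atTop (𝓝 0) :=
    fun K => tendsto_const_div_atTop_nhds_zero_nat K
  have hprob : ∀ (n t : ℕ), 0 < t →
      P.real {ω | N t ω = n} ≤ (4 * C / r ^ 2) / t + (2 * (n + 1) / r) / t := by
    intro n t ht
    have ht' : (0 : ℝ) < t := by exact_mod_cast ht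
    have hmono : Monotone ![(0 : ℝ≥0), t] := by
      rw [Fin.monotone_iff_le_succ]
      intro i
      fin_cases i
      simp
    have h1 := hN.measureReal_increments hmono ![n]
    simp only [Fin.forall_fin_one, Fin.prod_univ_one] at h1
    simp only [Fin.succ_zero_eq_one, Fin.castSucc_zero, Matrix.cons_val_zero, Matrix.cons_val_one,
      hN.zero, zero_add] at h1
    rw [h1]
    have hm := hN.ctmc.memLp_cumIntensity_sub θ r (zero_le : (0 : ℝ≥0) ≤ (t : ℝ≥0))
    have hCt := hC t
    simp only [NNReal.coe_zero, sub_zero, NNReal.coe_natCast] at hm hCt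
    -- If the intensity is at least `r * t / 2`, the decay of the mass gives the second term.
    -- Otherwise it deviates from `r * t` by more than `r * t / 2`, and the first term, of Chebyshev
    -- type, exceeds 1.
    have hpt : ∀ ω, poissonMass (cumIntensity θ J 0 t ω) n
        ≤ (4 / (r * t) ^ 2) * (cumIntensity θ J 0 t ω - r * t) ^ 2 + 2 * (n + 1) / (r * t) := by
      intro ω
      have hL : 0 ≤ cumIntensity θ J 0 t ω := cumIntensity_nonneg hθ zero_le ω
      have hrt : 0 < r * t := by positivity
      rcases le_or_gt (r * t / 2) (cumIntensity θ J 0 t ω) with h | h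
      · have h2 : poissonMass (cumIntensity θ J 0 t ω) n ≤ (n + 1) / (r * t / 2) :=
          (poissonMass_le_div (by linarith) n).trans (by gcongr)
        have h3 : ((n : ℝ) + 1) / (r * t / 2) = 2 * (n + 1) / (r * t) := by field_simp
        have : 0 ≤ (4 / (r * t) ^ 2) * (cumIntensity θ J 0 t ω - r * t) ^ 2 := by positivity
        linarith
      · have h2 : 1 ≤ (4 / (r * t) ^ 2) * (cumIntensity θ J 0 t ω - r * t) ^ 2 := by
          rw [div_mul_eq_mul_div, le_div_iff₀ (by positivity)]
          nlinarith
        have : 0 ≤ 2 * ((n : ℝ) + 1) / (r * t) := by positivity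
        linarith [poissonMass_le_one hL n]
    have hLm : Measurable fun ω => poissonMass (cumIntensity θ J 0 t ω) n :=
      (continuous_poissonMass n).measurable.comp (hN.ctmc.measurable_cumIntensity θ zero_le)
    have hsq : Integrable (fun ω => (cumIntensity θ J 0 t ω - r * t) ^ 2) P := hm.integrable_sq
    have hL0 : ∀ ω, 0 ≤ cumIntensity θ J 0 t ω := fun ω => cumIntensity_nonneg hθ zero_le ω
    calc ∫ ω, poissonMass (cumIntensity θ J 0 t ω) n ∂P
        ≤ ∫ ω, ((4 / (r * t) ^ 2) * (cumIntensity θ J 0 t ω - r * t) ^ 2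
            + 2 * (n + 1) / (r * t)) ∂P := by
          refine integral_mono (Integrable.of_bound hLm.aestronglyMeasurable 1
            (ae_of_all _ fun ω => ?_)) ((hsq.const_mul _).add (integrable_const _)) hpt
          rw [Real.norm_of_nonneg (poissonMass_nonneg (hL0 ω) n)]
          exact poissonMass_le_one (hL0 ω) n
      _ = (4 / (r * t) ^ 2) * ∫ ω, (cumIntensity θ J 0 t ω - r * t) ^ 2 ∂P
            + 2 * (n + 1) / (r * t) := by
          rw [integral_add (hsq.const_mul _) (integrable_const _), integral_const_mul]
          simp
      _ ≤ (4 / (r * t) ^ 2) * (C * t) + 2 * (n + 1) / (r * t) := by gcongr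
      _ = _ := by field_simp
  rw [ae_all_iff]
  intro k
  -- If level `k` is never reached, the count at every time is one of `0, …, k - 1`, and each of
  -- these values has vanishing probability as `t` grows.
  have hsub : ∀ t : ℕ, {ω | ¬ ∃ s : ℝ≥0, k ≤ N s ω} ⊆ ⋃ n ∈ Finset.range k, {ω | N t ω = n} := by
    intro t ω hω
    simp only [Set.mem_ofPred_eq, not_exists, not_le] at hω
    simpa using hω t
  have hle : ∀ t : ℕ, 0 < t → P.real {ω | ¬ ∃ s : ℝ≥0, k ≤ N s ω}
      ≤ ∑ n ∈ Finset.range k, ((4 * C / r ^ 2) / t + (2 * (n + 1) / r) / t) := fun t ht =>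
    (measureReal_mono (hsub t) (measure_ne_top _ _)).trans ((measureReal_biUnion_finset_le _ _).trans
      (Finset.sum_le_sum fun n _ => hprob n t ht))
  have hlim : Tendsto (fun t : ℕ =>
      ∑ n ∈ Finset.range k, ((4 * C / r ^ 2) / (t : ℝ) + (2 * ((n : ℝ) + 1) / r) / t)) atTop
      (𝓝 0) := by
    have := tendsto_finsetSum (Finset.range k) fun n _ =>
      (hlim0 (4 * C / r ^ 2)).add (hlim0 (2 * ((n : ℝ) + 1) / r))
    simpa using this
  have h0 : P.real {ω | ¬ ∃ s : ℝ≥0, k ≤ N s ω} ≤ 0 :=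
    ge_of_tendsto hlim (eventually_atTop.2 ⟨1, fun t ht => hle t ht⟩)
  rw [ae_iff]
  exact (measureReal_eq_zero_iff).1 (le_antisymm h0 measureReal_nonneg)

end

/-! ### Partial sums of independent exponential variables. -/

theorem measurableSet_partialSum_mem_Ioc {k : ℕ} (s : ℝ) (a b : Fin k → ℝ) :
    MeasurableSet {y : Fin k → ℝ | ∀ i, s + ∑ j ∈ Finset.Iic i, y j ∈ Set.Ioc (a i) (b i)} := by
  simp only [Set.ofPred_forall]
  refine MeasurableSet.iInter fun i => ?_
  have : Measurable fun y : Fin k → ℝ => s + ∑ j ∈ Finset.Iic i, y j := by fun_prop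
  exact this measurableSet_Ioc

theorem sum_Iic_fin_cons {k : ℕ} (x : ℝ) (y : Fin k → ℝ) (i : Fin k) :
    ∑ j ∈ Finset.Iic i.succ, (Fin.cons x y : Fin (k + 1) → ℝ) j = x + ∑ j ∈ Finset.Iic i, y j := by
  have h : ∀ {n : ℕ} (i : Fin n) (f : Fin n → ℝ),
      ∑ j ∈ Finset.Iic i, f j = ∑ j, if j ≤ i then f j else 0 := fun i f => by
    rw [← Finset.sum_filter]
    congr 1
    ext j
    simp
  rw [h, h, Fin.sum_univ_succ]
  simp

theorem expMeasure_Ioc {r : ℝ} (hr : 0 < r) {a b : ℝ} (ha : 0 ≤ a) (hab : a ≤ b) :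
    expMeasure r (Set.Ioc a b) = ENNReal.ofReal (Real.exp (-(r * a)) - Real.exp (-(r * b))) := by
  have := isProbabilityMeasure_expMeasure hr
  conv_lhs => rw [← measure_cdf (expMeasure r)]
  rw [StieltjesFunction.measure_Ioc, cdf_expMeasure_eq hr, cdf_expMeasure_eq hr, if_pos ha,
    if_pos (ha.trans hab)]
  congr 1
  ring

/-- Induction integrating out the first variable, which moves the starting point from `s` to `s +
x`; this is why `s` is arbitrary. The ordering of the sides keeps the new starting point below the
next interval. -/
theorem pi_expMeasure_partialSum_mem_Ioc {r : ℝ} (hr : 0 < r) (k : ℕ) :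
    ∀ (s : ℝ) (a b : ℕ → ℝ), s ≤ a 0 → (∀ i ≤ k, a i ≤ b i) → (∀ i < k, b i ≤ a (i + 1)) →
    Measure.pi (fun _ : Fin (k + 1) => expMeasure r)
        {y | ∀ i : Fin (k + 1), s + ∑ j ∈ Finset.Iic i, y j ∈ Set.Ioc (a i) (b i)}
      = ENNReal.ofReal (Real.exp (r * s) * ((∏ i ∈ Finset.range k, r * (b i - a i)) *
          (Real.exp (-(r * a k)) - Real.exp (-(r * b k))))) := by
  have := isProbabilityMeasure_expMeasure hr
  have hstep : ∀ (k : ℕ) (s : ℝ) (a b : ℕ → ℝ),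
      Measure.pi (fun _ : Fin (k + 1) => expMeasure r)
        {y | ∀ i : Fin (k + 1), s + ∑ j ∈ Finset.Iic i, y j ∈ Set.Ioc (a i) (b i)}
      = ∫⁻ x in Set.Ioc (a 0 - s) (b 0 - s), Measure.pi (fun _ : Fin k => expMeasure r)
          {y | ∀ i : Fin k, (s + x) + ∑ j ∈ Finset.Iic i, y j ∈ Set.Ioc (a (i + 1)) (b (i + 1))}
            ∂(expMeasure r) := by
    intro k s a b
    have hm := measurableSet_partialSum_mem_Ioc s (fun i : Fin (k + 1) => a i) fun i => b i
    have hmp := (measurePreserving_piFinSuccAbove (fun _ : Fin (k + 1) => expMeasure r) 0).symm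
    rw [← hmp.measure_preimage hm.nullMeasurableSet,
      Measure.prod_apply (hmp.measurable hm), ← lintegral_indicator measurableSet_Ioc]
    refine lintegral_congr fun x => ?_
    have hset : Prod.mk x ⁻¹' ((MeasurableEquiv.piFinSuccAbove (fun _ : Fin (k + 1) => ℝ) 0).symm ⁻¹'
        {y | ∀ i : Fin (k + 1), s + ∑ j ∈ Finset.Iic i, y j ∈ Set.Ioc (a i) (b i)})
        = {y : Fin k → ℝ | s + x ∈ Set.Ioc (a 0) (b 0) ∧
          ∀ i : Fin k, (s + x) + ∑ j ∈ Finset.Iic i, y j ∈ Set.Ioc (a (i + 1)) (b (i + 1))} := by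
      ext y
      have h0 : Finset.Iic (0 : Fin (k + 1)) = {0} := rfl
      have : (MeasurableEquiv.piFinSuccAbove (fun _ : Fin (k + 1) => ℝ) 0).symm (x, y)
          = Fin.cons x y := by
        simp [MeasurableEquiv.piFinSuccAbove]
        rfl
      simp only [Set.mem_preimage, Set.mem_ofPred_eq, this, Fin.forall_fin_succ, sum_Iic_fin_cons,
        h0, Finset.sum_singleton, Fin.cons_zero, Fin.val_zero, Fin.val_succ, add_assoc]
    rw [hset]
    by_cases hx : x ∈ Set.Ioc (a 0 - s) (b 0 - s)
    · rw [Set.indicator_of_mem hx]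
      have : s + x ∈ Set.Ioc (a 0) (b 0) := ⟨by linarith [hx.1], by linarith [hx.2]⟩
      simp only [this, true_and]
    · rw [Set.indicator_of_notMem hx]
      have : s + x ∉ Set.Ioc (a 0) (b 0) := fun h =>
        hx ⟨by linarith [h.1], by linarith [h.2]⟩
      simp only [this, false_and]
      exact measure_empty
  induction k with
  | zero =>
    intro s a b hs hab _
    rw [hstep]
    simp only [IsEmpty.forall_iff, Set.ofPred_true, measure_univ, lintegral_const, one_mul,
      Measure.restrict_apply_univ]
    rw [expMeasure_Ioc hr (by linarith) (by linarith [hab 0 le_rfl])]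
    congr 1
    simp only [Finset.range_zero, Finset.prod_empty, one_mul, mul_sub, ← Real.exp_add]
    congr 2 <;> ring
  | succ k ih =>
    intro s a b hs hab hba
    set c := (∏ i ∈ Finset.range k, r * (b (i + 1) - a (i + 1))) *
          (Real.exp (-(r * a (k + 1))) - Real.exp (-(r * b (k + 1)))) with hc
    have hc0 : 0 ≤ c := by
      refine mul_nonneg (Finset.prod_nonneg fun i hi => ?_) (sub_nonneg.2 (Real.exp_le_exp.2 ?_))
      · exact mul_nonneg hr.le (sub_nonneg.2 (hab _ (by rw [Finset.mem_range] at hi; omega)))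
      · exact neg_le_neg (mul_le_mul_of_nonneg_left (hab _ le_rfl) hr.le)
    have h1 : ∀ x ∈ Set.Ioc (a 0 - s) (b 0 - s), Measure.pi (fun _ : Fin (k + 1) => expMeasure r)
          {y | ∀ i : Fin (k + 1), (s + x) + ∑ j ∈ Finset.Iic i, y j
            ∈ Set.Ioc (a (i + 1)) (b (i + 1))} = ENNReal.ofReal (Real.exp (r * (s + x)) * c) := by
      intro x hx
      exact ih (s + x) (fun i => a (i + 1)) (fun i => b (i + 1))
        (by linarith [hx.2, hba 0 (Nat.succ_pos k)]) (fun i hi => hab _ (by omega))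
        fun i hi => hba _ (by omega)
    have hmeas : Measurable fun x => ENNReal.ofReal (Real.exp (r * (s + x)) * c) := by fun_prop
    have hpdf : Measurable (exponentialPDF r) :=
      (measurable_exponentialPDFReal r).ennreal_ofReal
    have hexp : expMeasure r = volume.withDensity (exponentialPDF r) := rfl
    -- The density cancels the factor `exp (r * x)` left by the induction hypothesis, so the
    -- integrand is constant and each side but the last contributes only its length times `r`.
    have h2 : ∀ x ∈ Set.Ioc (a 0 - s) (b 0 - s),
        (exponentialPDF r * fun x => ENNReal.ofReal (Real.exp (r * (s + x)) * c)) x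
          = ENNReal.ofReal (r * Real.exp (r * s) * c) := by
      intro x hx
      simp only [Pi.mul_apply]
      rw [exponentialPDF_of_nonneg (by linarith [hx.1]), ← ENNReal.ofReal_mul (by positivity)]
      congr 1
      have : Real.exp (r * (s + x)) = Real.exp (r * s) * Real.exp (r * x) := by
        rw [← Real.exp_add]; ring_nf
      rw [this, Real.exp_neg]
      field_simp
    rw [hstep, setLIntegral_congr_fun measurableSet_Ioc h1, hexp,
      setLIntegral_withDensity_eq_setLIntegral_mul _ hpdf hmeas measurableSet_Ioc,
      setLIntegral_congr_fun measurableSet_Ioc h2, setLIntegral_const, Real.volume_Ioc,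
      ← ENNReal.ofReal_mul (by positivity), Finset.prod_range_succ']
    congr 1
    rw [hc]
    ring

/-- The joint law of the partial sums of independent exponential variables, on boxes whose sides
are ordered one after the other. -/
theorem infinitePi_expMeasure_partialSum_mem_Ioc {r : ℝ} (hr : 0 < r)
    [IsProbabilityMeasure (expMeasure r)] (k : ℕ)
    {a b : ℕ → ℝ} (ha : 0 ≤ a 0) (hab : ∀ i ≤ k, a i ≤ b i) (hba : ∀ i < k, b i ≤ a (i + 1)) :
    Measure.infinitePi (fun _ : ℕ => expMeasure r)
        {z | ∀ i ≤ k, ∑ j ∈ Finset.range (i + 1), z j ∈ Set.Ioc (a i) (b i)}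
      = ENNReal.ofReal ((∏ i ∈ Finset.range k, r * (b i - a i)) *
          (Real.exp (-(r * a k)) - Real.exp (-(r * b k)))) := by
  have hmap : (Measure.infinitePi fun _ : ℕ => expMeasure r).map
      (fun z (i : Fin (k + 1)) => z i) = Measure.pi fun _ : Fin (k + 1) => expMeasure r := by
    rw [← Measure.infinitePi_eq_pi]
    exact Measure.map_infinitePi_infinitePi_of_inj
      (f := fun i : Fin (k + 1) => (i : ℕ)) Fin.val_injective
  have h := pi_expMeasure_partialSum_mem_Ioc hr k 0 a b ha hab hba
  rw [mul_zero, Real.exp_zero, one_mul] at h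
  rw [← h, ← hmap, Measure.map_apply (by fun_prop) (measurableSet_partialSum_mem_Ioc _ _ _)]
  congr 1
  ext z
  have hsum : ∀ i : Fin (k + 1), ∑ j ∈ Finset.Iic i, z j = ∑ j ∈ Finset.range (i + 1), z j := by
    intro i
    have he : Finset.range ((i : ℕ) + 1) = (Finset.Iic i).map Fin.valEmbedding := by
      rw [Fin.map_valEmbedding_Iic]
      ext
      simp
    rw [he, Finset.sum_map]
    rfl
  simp only [Set.mem_ofPred_eq, Set.mem_preimage, zero_add, hsum]
  exact ⟨fun H i => H i (Nat.lt_succ_iff.1 i.2), fun H i hi => H ⟨i, Nat.lt_succ_iff.2 hi⟩⟩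

theorem ae_infinitePi_expMeasure_pos {r : ℝ} (hr : 0 < r) [IsProbabilityMeasure (expMeasure r)] :
    ∀ᵐ z ∂(Measure.infinitePi fun _ : ℕ => expMeasure r), ∀ i, 0 < z i := by
  rw [ae_all_iff]
  intro i
  have h : ∀ᵐ x ∂(expMeasure r), 0 < x := by
    have h0 : cdf (expMeasure r) 0 = 0 := by simp [cdf_expMeasure_eq hr]
    rw [cdf_eq_real, measureReal_eq_zero_iff] at h0
    rw [ae_iff]
    convert h0 using 2
    ext x
    simp
  exact (measurePreserving_eval_infinitePi (fun _ : ℕ => expMeasure r) i).quasiMeasurePreserving.ae h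

/-! ### Arrival times in terms of counts. -/

section

variable {Ω : Type*} {N : ℝ≥0 → Ω → ℕ} {ω : Ω}

theorem arrivalTime_zero (N : ℝ≥0 → Ω → ℕ) (ω : Ω) : arrivalTime N 0 ω = 0 := by
  simp [arrivalTime]

/-- A right-continuous integer-valued path is constant just after the infimum, so the infimum is
attained. Existence is needed since `sInf ∅ = 0` in `ℝ≥0`. -/
theorem arrivalTime_le_iff (hmono : Monotone fun t => N t ω)
    (hrc : ∀ t, ContinuousWithinAt (fun s => N s ω) (Set.Ici t) t) {k : ℕ}
    (hex : ∃ t, k ≤ N t ω) (t : ℝ≥0) : arrivalTime N k ω ≤ t ↔ k ≤ N t ω := by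
  rw [arrivalTime, NNReal.coe_le_coe]
  refine ⟨fun h => ?_, fun h => csInf_le' h⟩
  set T := sInf {t | k ≤ N t ω} with hT
  refine le_trans ?_ (hmono h)
  have h1 : ∀ᶠ s in 𝓝[≥] T, N s ω = N T ω :=
    (hrc T).tendsto.eventually (p := fun n => n = N T ω) (mem_nhds_discrete.2 rfl)
  obtain ⟨u, hu, hu'⟩ := (mem_nhdsGE_iff_exists_Ico_subset' (lt_add_one T)).1 h1
  obtain ⟨s, hs, hsu⟩ := exists_lt_of_csInf_lt (s := {t | k ≤ N t ω}) hex hu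
  have h2 : N s ω = N T ω := hu' ⟨csInf_le' hs, hsu⟩
  exact le_of_le_of_eq hs h2

theorem measurable_arrivalTime [MeasurableSpace Ω] (hmeas : ∀ t, Measurable (N t))
    (hmono : ∀ ω, Monotone fun t => N t ω)
    (hrc : ∀ ω t, ContinuousWithinAt (fun s => N s ω) (Set.Ici t) t) (k : ℕ) :
    Measurable (arrivalTime N k) := by
  refine measurable_of_Iic fun x => ?_
  rcases lt_or_ge x 0 with hx | hx
  · convert MeasurableSet.empty
    ext ω
    simpa using hx.trans_le (show 0 ≤ arrivalTime N k ω from NNReal.coe_nonneg _)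
  · lift x to ℝ≥0 using hx
    -- The second set is where level `k` is never reached; there `arrivalTime` has the default value
    -- `0`.
    have : arrivalTime N k ⁻¹' Set.Iic (x : ℝ) = {ω | k ≤ N x ω} ∪ ⋂ n : ℕ, {ω | N n ω < k} := by
      ext ω
      simp only [Set.mem_preimage, Set.mem_Iic, Set.mem_union, Set.mem_ofPred_eq, Set.mem_iInter]
      by_cases hex : ∃ t, k ≤ N t ω
      · rw [arrivalTime_le_iff (hmono ω) (hrc ω) hex]
        refine ⟨Or.inl, fun h => h.resolve_right fun h' => ?_⟩
        obtain ⟨t, ht⟩ := hex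
        obtain ⟨n, hn⟩ := exists_nat_ge t
        exact (h' n).not_ge (ht.trans (hmono ω hn))
      · have h0 : {t | k ≤ N t ω} = ∅ := by
          ext t
          simpa using not_le.1 fun h => hex ⟨t, h⟩
        refine ⟨fun _ => Or.inr fun n => not_le.1 fun h => hex ⟨n, h⟩, fun _ => ?_⟩
        simp [arrivalTime, h0]
    rw [this]
    exact (measurableSet_le measurable_const (hmeas x)).union
      (MeasurableSet.iInter fun n => measurableSet_lt (hmeas n) measurable_const)

end

/-- A nondecreasing sequence of counts started at `0` crosses the level `i + 1` between the times
`2 i + 1` and `2 i + 2`, `i ≤ k`, if and only if its increments before time `2 k + 1` are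
`0, 1, 0, 1, …, 0` and the next one does not vanish. -/
theorem forall_crossing_iff {M : ℕ → ℕ} {k : ℕ} (h0 : M 0 = 0)
    (hM : ∀ j < 2 * k + 2, M j ≤ M (j + 1)) :
    (∀ i ≤ k, M (2 * i + 1) < i + 1 ∧ i + 1 ≤ M (2 * i + 2)) ↔
      (∀ j < 2 * k + 1, M (j + 1) = M j + j % 2) ∧
        ¬ ((∀ j < 2 * k + 1, M (j + 1) = M j + j % 2) ∧ M (2 * k + 2) = M (2 * k + 1)) := by
  constructor
  · intro h
    -- The crossings bound `M (2 * i + 2)` below by `i + 1` and `M (2 * i + 3)` above by `i + 1`, so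
    -- monotonicity determines all values before the last; the last increment need only be nonzero.
    have hhalf : ∀ j ≤ 2 * k + 1, M j = j / 2 := by
      intro j hj
      induction j with
      | zero => simpa using h0
      | succ j ih =>
        have ih := ih (by omega)
        have h1 := hM j (by omega)
        rcases Nat.even_or_odd' j with ⟨i, rfl | rfl⟩
        · have := h i (by omega)
          omega
        · have h2 := h i (by omega)
          have h3 := h (i + 1) (by omega)
          have h4 := hM (2 * i + 2) (by omega)
          have : 2 * (i + 1) + 1 = 2 * i + 2 + 1 := by ring
          rw [this] at h3
          have : 2 * i + 1 + 1 = 2 * i + 2 := by ring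
          rw [this]
          omega
    refine ⟨fun j hj => ?_, fun h' => ?_⟩
    · rw [hhalf j (by omega), hhalf (j + 1) (by omega)]
      omega
    · have := h k le_rfl
      omega
  · rintro ⟨h1, h2⟩ i hi
    have h3 : M (2 * k + 2) ≠ M (2 * k + 1) := fun h => h2 ⟨h1, h⟩
    have hhalf : ∀ j ≤ 2 * k + 1, M j = j / 2 := by
      intro j hj
      induction j with
      | zero => simpa using h0
      | succ j ih => rw [h1 j (by omega), ih (by omega)]; omega
    have h4 := hM (2 * k + 1) (by omega)
    have h5 := hhalf (2 * i + 1) (by omega)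
    have h6 := hhalf (2 * k + 1) (by omega)
    rcases hi.eq_or_lt with rfl | hi
    · exact ⟨by omega, by grind⟩
    · have := hhalf (2 * i + 2) (by omega)
      omega

/-- Each factor carries an exponential of its interval length, and these telescope; the intervals
with one arrival leave the linear factors. -/
theorem prod_poissonMass_alternating (r : ℝ) (s : ℕ → ℝ) (h0 : s 0 = 0) (k : ℕ) :
    ∏ j ∈ Finset.range (2 * k + 1), poissonMass (r * (s (j + 1) - s j)) (j % 2)
      = (∏ i ∈ Finset.range k, r * (s (2 * i + 2) - s (2 * i + 1)))
        * Real.exp (-(r * s (2 * k + 1))) := by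
  induction k with
  | zero => simp [poissonMass, h0]
  | succ k ih =>
    have h1 : (2 * k + 1) % 2 = 1 := by omega
    have h2 : (2 * k + 1 + 1) % 2 = 0 := by omega
    rw [show 2 * (k + 1) + 1 = 2 * k + 1 + 1 + 1 by ring, Finset.prod_range_succ,
      Finset.prod_range_succ, ih, h1, h2, Finset.prod_range_succ]
    have h3 : Real.exp (-(r * s (2 * k + 1 + 1 + 1))) = Real.exp (-(r * s (2 * k + 1)))
        * Real.exp (-(r * (s (2 * k + 1 + 1) - s (2 * k + 1))))
        * Real.exp (-(r * (s (2 * k + 1 + 1 + 1) - s (2 * k + 1 + 1)))) := by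
      rw [← Real.exp_add, ← Real.exp_add]
      ring_nf
    rw [h3]
    simp only [poissonMass, pow_one, pow_zero, Nat.factorial_one, Nat.factorial_zero, Nat.cast_one,
      div_one, mul_one, show 2 * k + 2 = 2 * k + 1 + 1 by ring]
    ring

theorem measurableSet_increments {Ω : Type*} [MeasurableSpace Ω] {N : ℝ≥0 → Ω → ℕ}
    (hN : ∀ t, Measurable (N t)) (l : ℕ) (τ : ℕ → ℝ≥0) (n : ℕ → ℕ) :
    MeasurableSet {ω | ∀ j < l, N (τ (j + 1)) ω = N (τ j) ω + n j} := by
  simp only [Set.ofPred_forall]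
  exact MeasurableSet.iInter fun j => MeasurableSet.iInter fun _ =>
    measurableSet_eq_fun (hN _) ((hN _).add_const _)

/-- If the increments of counting processes converge to those of a Poisson process, then the
arrival times converge in law on boxes whose sides are ordered one after the other. -/
theorem tendsto_measureReal_arrivalTime_mem_Ioc {r : ℝ} {Ω : ℝ≥0 → Type*}
    [∀ x, MeasurableSpace (Ω x)] (P : (x : ℝ≥0) → Measure (Ω x)) [∀ x, IsProbabilityMeasure (P x)]
    (N : (x : ℝ≥0) → ℝ≥0 → Ω x → ℕ) (hmeas : ∀ x t, Measurable (N x t))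
    (hzero : ∀ x ω, N x 0 ω = 0) (hmono : ∀ x ω, Monotone fun t => N x t ω)
    (hrc : ∀ x ω t, ContinuousWithinAt (fun s => N x s ω) (Set.Ici t) t)
    (hex : ∀ x, 0 < x → ∀ᵐ ω ∂(P x), ∀ k : ℕ, ∃ t : ℝ≥0, k ≤ N x t ω)
    (hlim : ∀ (l : ℕ) (t : Fin (l + 1) → ℝ≥0), Monotone t → ∀ n : Fin l → ℕ,
      Tendsto (fun x => (P x).real
          {ω | ∀ i : Fin l, N x (t i.succ) ω = N x (t i.castSucc) ω + n i}) atTop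
        (𝓝 (∏ i : Fin l, poissonMass (r * ((t i.succ : ℝ) - (t i.castSucc : ℝ))) (n i))))
    (k : ℕ) {a b : ℕ → ℝ} (ha : 0 ≤ a 0) (hab : ∀ i ≤ k, a i ≤ b i)
    (hba : ∀ i < k, b i ≤ a (i + 1)) :
    Tendsto (fun x => (P x).real
        {ω | ∀ i ≤ k, arrivalTime (N x) (i + 1) ω ∈ Set.Ioc (a i) (b i)}) atTop
      (𝓝 ((∏ i ∈ Finset.range k, r * (b i - a i)) *
          (Real.exp (-(r * a k)) - Real.exp (-(r * b k))))) := by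
  have ha0 : ∀ i ≤ k, 0 ≤ a i := by
    intro i hi
    induction i with
    | zero => exact ha
    | succ i ih => linarith [ih (by omega), hab i (by omega), hba i (by omega)]
  have hb0 : ∀ i ≤ k, 0 ≤ b i := fun i hi => (ha0 i hi).trans (hab i hi)
  -- The times `0, a 0, b 0, a 1, b 1, …`, so that the desired counts are `0` and `1` alternately.
  let τ : ℕ → ℝ≥0 := fun j => if j = 0 then 0 else if j % 2 = 1 then (a (j / 2)).toNNReal
    else (b (j / 2 - 1)).toNNReal
  have hτ0 : τ 0 = 0 := rfl
  have hτa : ∀ i, τ (2 * i + 1) = (a i).toNNReal := by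
    intro i
    have h1 : (2 * i + 1) % 2 = 1 := by omega
    have h2 : (2 * i + 1) / 2 = i := by omega
    simp only [τ, h1, h2]
    simp
  have hτb : ∀ i, τ (2 * i + 2) = (b i).toNNReal := by
    intro i
    have h1 : (2 * i + 2) % 2 = 0 := by omega
    have h2 : (2 * i + 2) / 2 - 1 = i := by omega
    simp only [τ, h1, h2]
    simp
  have hτ : ∀ j < 2 * k + 2, τ j ≤ τ (j + 1) := by
    intro j hj
    rcases Nat.even_or_odd' j with ⟨i, rfl | rfl⟩
    · rcases i with _ | i
      · simp [hτ0]
      · rw [hτa, show 2 * (i + 1) = 2 * i + 2 by ring, hτb]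
        exact Real.toNNReal_le_toNNReal (hba i (by omega))
    · rw [hτa, show 2 * i + 1 + 1 = 2 * i + 2 by ring, hτb]
      exact Real.toNNReal_le_toNNReal (hab i (by omega))
  have hlim' : ∀ l ≤ 2 * k + 2, ∀ n : ℕ → ℕ, Tendsto (fun x => (P x).real
      {ω | ∀ j < l, N x (τ (j + 1)) ω = N x (τ j) ω + n j}) atTop
      (𝓝 (∏ j ∈ Finset.range l, poissonMass (r * ((τ (j + 1) : ℝ) - τ j)) (n j))) := by
    intro l hl n
    have hm : Monotone fun i : Fin (l + 1) => τ i := by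
      rw [Fin.monotone_iff_le_succ]
      intro i
      exact hτ i (by omega)
    have h := hlim l (fun i => τ i) hm fun i => n i
    simp only [Fin.val_succ, Fin.val_castSucc, Fin.forall_iff] at h
    rwa [Fin.prod_univ_eq_prod_range
      (fun j => poissonMass (r * ((τ (j + 1) : ℝ) - τ j)) (n j)) l] at h
  -- The alternating pattern followed by an empty last interval. Subtracting its event expresses "at
  -- least one arrival" there without an infinite sum.
  obtain ⟨n2, hn2, hn2'⟩ : ∃ n2 : ℕ → ℕ, (∀ j < 2 * k + 1, n2 j = j % 2) ∧ n2 (2 * k + 1) = 0 :=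
    ⟨fun j => if j < 2 * k + 1 then j % 2 else 0, fun j hj => if_pos hj, if_neg (lt_irrefl _)⟩
  have hiff2 : ∀ M : ℕ → ℕ, (∀ j < 2 * k + 2, M (j + 1) = M j + n2 j) ↔
      (∀ j < 2 * k + 1, M (j + 1) = M j + j % 2) ∧ M (2 * k + 2) = M (2 * k + 1) := by
    intro M
    constructor
    · intro h
      refine ⟨fun j hj => ?_, ?_⟩
      · rw [h j (by omega), hn2 j hj]
      · rw [h (2 * k + 1) (by omega), hn2', add_zero]
    · rintro ⟨h, h'⟩ j hj
      rcases (Nat.lt_succ_iff.1 hj).eq_or_lt with rfl | hj'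
      · rw [hn2', add_zero, ← h']
      · rw [hn2 j hj', h j hj']
  have h1 := hlim' (2 * k + 1) (by omega) fun j => j % 2
  have h2 := hlim' (2 * k + 2) le_rfl n2
  rw [prod_poissonMass_alternating r (fun j => (τ j : ℝ)) (by simp [hτ0])] at h1
  rw [Finset.prod_range_succ, Finset.prod_congr rfl (g := fun j =>
      poissonMass (r * ((τ (j + 1) : ℝ) - τ j)) (j % 2)) (fun j hj => by
        rw [hn2 j (Finset.mem_range.1 hj)]),
    prod_poissonMass_alternating r (fun j => (τ j : ℝ)) (by simp [hτ0])] at h2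
  have hprod : ∏ i ∈ Finset.range k, r * ((τ (2 * i + 2) : ℝ) - τ (2 * i + 1))
      = ∏ i ∈ Finset.range k, r * (b i - a i) := by
    refine Finset.prod_congr rfl fun i hi => ?_
    have hi := (Finset.mem_range.1 hi).le
    rw [hτa, hτb, Real.coe_toNNReal _ (ha0 i hi), Real.coe_toNNReal _ (hb0 i hi)]
  have hval : poissonMass (r * ((τ (2 * k + 1 + 1) : ℝ) - τ (2 * k + 1))) (n2 (2 * k + 1))
      = Real.exp (-(r * (b k - a k))) := by
    rw [hτa, show 2 * k + 1 + 1 = 2 * k + 2 by ring, hτb, Real.coe_toNNReal _ (ha0 k le_rfl),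
      Real.coe_toNNReal _ (hb0 k le_rfl)]
    simp [hn2', poissonMass]
  rw [hprod, hτa, Real.coe_toNNReal _ (ha0 k le_rfl)] at h1
  rw [hprod, hval, hτa, Real.coe_toNNReal _ (ha0 k le_rfl)] at h2
  have hexp : Real.exp (-(r * b k)) = Real.exp (-(r * a k)) * Real.exp (-(r * (b k - a k))) := by
    rw [← Real.exp_add]; ring_nf
  have h3 := h1.sub h2
  rw [hexp, mul_sub, ← mul_assoc]
  refine h3.congr' ?_
  filter_upwards [eventually_gt_atTop 0] with x hx
  have hsub : {ω | ∀ j < 2 * k + 2, N x (τ (j + 1)) ω = N x (τ j) ω + n2 j} ⊆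
      {ω | ∀ j < 2 * k + 1, N x (τ (j + 1)) ω = N x (τ j) ω + j % 2} := fun ω hω =>
    ((hiff2 fun j => N x (τ j) ω).1 hω).1
  rw [← measureReal_sdiff hsub (measurableSet_increments (hmeas x) _ τ n2)]
  refine measureReal_congr ?_
  filter_upwards [hex x hx] with ω hω
  refine propext ?_
  have hT : ∀ i (y : ℝ), 0 ≤ y → (arrivalTime (N x) (i + 1) ω ≤ y ↔ i + 1 ≤ N x y.toNNReal ω) := by
    intro i y hy
    rw [← arrivalTime_le_iff (hmono x ω) (hrc x ω) (hω _), Real.coe_toNNReal _ hy]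
  have hM := forall_crossing_iff (M := fun j => N x (τ j) ω) (k := k) (by simp [hτ0, hzero])
    fun j hj => hmono x ω (hτ j hj)
  change (_ ∧ ¬ _) ↔ _
  change ((∀ j < 2 * k + 1, _) ∧ ¬ (∀ j < 2 * k + 2, _)) ↔ (∀ i ≤ k, _ ∈ Set.Ioc _ _)
  rw [hiff2 fun j => N x (τ j) ω, ← hM]
  refine forall₂_congr fun i hi => ?_
  rw [Set.mem_Ioc, ← not_le, ← not_le, hT i _ (ha0 i hi), hT i _ (hb0 i hi), hτa, hτb]

/-! ### Weak convergence from ordered boxes. -/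

/-- Convergence on a π-system that contains arbitrarily small neighbourhoods of almost every point
for the limiting measure implies weak convergence. -/
theorem IsPiSystem.tendsto_probabilityMeasure_of_ae_nhds {E ι : Type*} [MeasurableSpace E]
    [TopologicalSpace E] [SecondCountableTopology E] [OpensMeasurableSpace E] {S : Set (Set E)}
    (hS : IsPiSystem S) {μ : ι → ProbabilityMeasure E} {ν : ProbabilityMeasure E} {l : Filter ι}
    [l.IsCountablyGenerated] (hmeas : ∀ s ∈ S, MeasurableSet s) {C : Set E}
    (hC : ∀ᵐ z ∂(ν : Measure E), z ∈ C)
    (h : ∀ u : Set E, IsOpen u → ∀ z ∈ u, z ∈ C → ∃ s ∈ S, s ∈ 𝓝 z ∧ s ⊆ u)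
    (h' : ∀ s ∈ S, Tendsto (fun i => μ i s) l (𝓝 (ν s))) : Tendsto μ l (𝓝 ν) := by
  rcases l.eq_or_neBot with rfl | hl
  · simp
  refine tendsto_of_forall_isOpen_le_liminf fun G hG => ?_
  refine (le_liminf_iff (isCoboundedUnder_ge_of_le (x := 1) l (by simp))
    (by isBoundedDefault)).2 fun r hr => ?_
  have : ∀ z : (G ∩ C : Set E), ∃ s ∈ S, s ∈ 𝓝 (z : E) ∧ s ⊆ G := fun z => h G hG z z.2.1 z.2.2
  choose s hsS hs_nhds hsG using this
  -- Lindelöf: countably many sets of `S` inside `G` cover `G` up to a `ν`-null set. Finitely many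
  -- of them already have measure above `r`, and convergence on a π-system passes to finite unions.
  obtain ⟨T₀, hT₀c, hT₀⟩ := TopologicalSpace.isOpen_iUnion_countable (fun i => interior (s i))
    fun i => isOpen_interior
  have hcover : G ∩ C ⊆ ⋃ i ∈ T₀, s i := by
    intro z hz
    have h1 : z ∈ ⋃ i, interior (s i) :=
      Set.mem_iUnion.2 ⟨⟨z, hz⟩, mem_interior_iff_mem_nhds.2 (hs_nhds ⟨z, hz⟩)⟩
    rw [← hT₀] at h1
    exact Set.iUnion₂_mono (fun i _ => interior_subset) h1
  have hne : T₀.Nonempty := by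
    rw [Set.nonempty_iff_ne_empty]
    rintro rfl
    have h0 : (ν : Measure E) G = 0 := by
      refine measure_mono_null_ae ?_ (measure_empty (μ := (ν : Measure E)))
      filter_upwards [hC] with z hz hzG
      simpa using hcover ⟨hzG, hz⟩
    have : ν G = 0 := by
      rw [← ENNReal.coe_inj, ProbabilityMeasure.ennreal_coeFn_eq_coeFn_toMeasure]
      simpa using h0
    simp [this] at hr
  obtain ⟨f, hf⟩ := hT₀c.exists_eq_range hne
  have hle : ν G ≤ ν (⋃ n, s (f n)) := by
    rw [← ENNReal.coe_le_coe, ProbabilityMeasure.ennreal_coeFn_eq_coeFn_toMeasure,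
      ProbabilityMeasure.ennreal_coeFn_eq_coeFn_toMeasure]
    refine measure_mono_ae ?_
    filter_upwards [hC] with z hz hzG
    have := hcover ⟨hzG, hz⟩
    rw [hf, Set.biUnion_range] at this
    exact this
  have hacc : Tendsto (fun i => ν (Set.accumulate (fun n => s (f n)) i)) atTop
      (𝓝 (ν (⋃ n, s (f n)))) :=
    (ENNReal.tendsto_toNNReal_iff (by simp) (by simp)).2 tendsto_measure_iUnion_accumulate
  obtain ⟨n, hn⟩ := ((tendsto_order.1 hacc).1 r (hr.trans_le hle)).exists
  classical
  have hT : ∀ t ∈ (Finset.range (n + 1)).image (fun n => s (f n)), t ∈ S := by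
    intro t ht
    obtain ⟨i, _, rfl⟩ := Finset.mem_image.1 ht
    exact hsS _
  have hunion : ⋃ t ∈ (Finset.range (n + 1)).image (fun n => s (f n)), t
      = Set.accumulate (fun n => s (f n)) n := by
    simp [Set.accumulate_def]
  have hconv := hS.tendsto_probabilityMeasure_biUnion hT hmeas h'
  rw [hunion] at hconv
  filter_upwards [(tendsto_order.1 hconv).1 r hn] with i hi
  refine hi.trans_le (ProbabilityMeasure.apply_mono _ ?_)
  intro z hz
  obtain ⟨j, _, hj⟩ := Set.mem_accumulate.1 hz
  exact hsG _ hj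

/-- Cylinders over boxes whose sides are nonnegative intervals ordered one after the other. -/
def orderedBoxes : Set (Set (ℕ → ℝ)) :=
  {s | ∃ (k : ℕ) (a b : ℕ → ℝ), 0 ≤ a 0 ∧ (∀ i ≤ k, a i ≤ b i) ∧ (∀ i < k, b i ≤ a (i + 1)) ∧
    s = {z | ∀ i ≤ k, z i ∈ Set.Ioc (a i) (b i)}}

theorem measurableSet_of_mem_orderedBoxes {s : Set (ℕ → ℝ)} (hs : s ∈ orderedBoxes) :
    MeasurableSet s := by
  obtain ⟨k, a, b, -, -, -, rfl⟩ := hs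
  simp only [Set.ofPred_forall]
  exact MeasurableSet.iInter fun i => MeasurableSet.iInter fun _ =>
    measurable_pi_apply i measurableSet_Ioc

/-- Sides are intersected on the shared coordinates and taken from the longer box beyond. They lie
within the sides of the longer box, hence remain ordered; a common point keeps their endpoints in
order. -/
theorem isPiSystem_orderedBoxes : IsPiSystem orderedBoxes := by
  have key : ∀ (k k' : ℕ) (a b a' b' : ℕ → ℝ), k ≤ k' → 0 ≤ a 0 → (∀ i < k', b' i ≤ a' (i + 1)) →
      (∀ i ≤ k', a' i ≤ b' i) →
      ({z : ℕ → ℝ | ∀ i ≤ k, z i ∈ Set.Ioc (a i) (b i)} ∩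
        {z | ∀ i ≤ k', z i ∈ Set.Ioc (a' i) (b' i)}).Nonempty →
      {z : ℕ → ℝ | ∀ i ≤ k, z i ∈ Set.Ioc (a i) (b i)} ∩
        {z | ∀ i ≤ k', z i ∈ Set.Ioc (a' i) (b' i)} ∈ orderedBoxes := by
    rintro k k' a b a' b' hk ha hba' hab' ⟨z, hz, hz'⟩
    refine ⟨k', fun i => if i ≤ k then max (a i) (a' i) else a' i,
      fun i => if i ≤ k then min (b i) (b' i) else b' i, ?_, ?_, ?_, ?_⟩
    · simpa using Or.inl ha
    · intro i hi
      simp only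
      split_ifs with h
      · have h1 := hz i h
        have h2 := hz' i hi
        exact (max_lt h1.1 h2.1).le.trans (le_min h1.2 h2.2)
      · exact hab' i hi
    · intro i hi
      have h1 : (if i ≤ k then min (b i) (b' i) else b' i) ≤ b' i := by
        split_ifs
        · exact min_le_right _ _
        · exact le_rfl
      have h2 : a' (i + 1) ≤ if i + 1 ≤ k then max (a (i + 1)) (a' (i + 1)) else a' (i + 1) := by
        split_ifs
        · exact le_max_right _ _
        · exact le_rfl
      exact h1.trans ((hba' i hi).trans h2)
    · ext y
      simp only [Set.mem_inter_iff, Set.mem_ofPred_eq, Set.mem_Ioc]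
      constructor
      · rintro ⟨h1, h2⟩ i hi
        split_ifs with h
        · exact ⟨max_lt (h1 i h).1 (h2 i hi).1, le_min (h1 i h).2 (h2 i hi).2⟩
        · exact h2 i hi
      · intro h
        refine ⟨fun i hi => ?_, fun i hi => ?_⟩
        · have := h i (hi.trans hk)
          rw [if_pos hi, if_pos hi, max_lt_iff, le_min_iff] at this
          exact ⟨this.1.1, this.2.1⟩
        · have := h i hi
          split_ifs at this
          · rw [max_lt_iff, le_min_iff] at this
            exact ⟨this.1.2, this.2.2⟩
          · exact this
  rintro _ ⟨k, a, b, ha, hab, hba, rfl⟩ _ ⟨k', a', b', ha', hab', hba', rfl⟩ hne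
  rcases le_total k k' with hk | hk
  · exact key k k' a b a' b' hk ha hba' hab' hne
  · rw [Set.inter_comm] at hne ⊢
    exact key k' k a' b' a b hk ha' hba hab hne

theorem exists_mem_orderedBoxes_subset {u : Set (ℕ → ℝ)} (hu : IsOpen u) {z : ℕ → ℝ} (hzu : z ∈ u)
    (hz0 : 0 < z 0) (hz : ∀ i, z i < z (i + 1)) : ∃ s ∈ orderedBoxes, s ∈ 𝓝 z ∧ s ⊆ u := by
  obtain ⟨I, v, hv, hvu⟩ := isOpen_pi_iff.1 hu z hzu
  -- Half of each neighbouring gap prevents overlap of consecutive sides, and `δ ≤ z 0` keeps the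
  -- first side nonnegative. Coordinates outside `I` are constrained too, since a box involves all
  -- indices up to its last.
  have hδ : ∀ i, ∃ δ > 0, (i ∈ I → Set.Ioc (z i - δ) (z i + δ) ⊆ v i) ∧
      δ ≤ (z (i + 1) - z i) / 2 ∧ δ ≤ z 0 ∧ ∀ j, i = j + 1 → δ ≤ (z i - z j) / 2 := by
    intro i
    obtain ⟨ε, hε, hεv⟩ : ∃ ε > 0, i ∈ I → Set.Ioc (z i - ε) (z i + ε) ⊆ v i := by
      by_cases hi : i ∈ I
      · obtain ⟨ε, hε, hεv⟩ := Metric.nhds_basis_closedBall.mem_iff.1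
          ((hv i hi).1.mem_nhds (hv i hi).2)
        refine ⟨ε, hε, fun _ => ?_⟩
        rw [Real.closedBall_eq_Icc] at hεv
        exact Set.Ioc_subset_Icc_self.trans hεv
      · exact ⟨1, one_pos, fun h => absurd h hi⟩
    have hmono : ∀ δ ≤ ε, i ∈ I → Set.Ioc (z i - δ) (z i + δ) ⊆ v i := fun δ hδ hi =>
      (Set.Ioc_subset_Ioc (by linarith) (by linarith)).trans (hεv hi)
    have h1 : 0 < (z (i + 1) - z i) / 2 := by linarith [hz i]
    rcases i with _ | j
    · refine ⟨min ε (min ((z 1 - z 0) / 2) (z 0)), lt_min hε (lt_min h1 hz0),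
        hmono _ (min_le_left _ _), (min_le_right _ _).trans (min_le_left _ _),
        (min_le_right _ _).trans (min_le_right _ _), fun j hj => absurd hj (by omega)⟩
    · refine ⟨min (min ε ((z (j + 1) - z j) / 2)) (min ((z (j + 1 + 1) - z (j + 1)) / 2) (z 0)),
        lt_min (lt_min hε (by linarith [hz j])) (lt_min h1 hz0),
        hmono _ ((min_le_left _ _).trans (min_le_left _ _)),
        (min_le_right _ _).trans (min_le_left _ _),
        (min_le_right _ _).trans (min_le_right _ _), fun j' hj' => ?_⟩
      obtain rfl : j = j' := by omega
      exact (min_le_left _ _).trans (min_le_right _ _)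
  choose δ hδ0 hδv hδ1 hδ2 hδ3 using hδ
  refine ⟨_, ⟨I.sup id, fun i => z i - δ i, fun i => z i + δ i, by linarith [hδ2 0],
    fun i _ => by linarith [hδ0 i], fun i _ => ?_, rfl⟩, ?_, ?_⟩
  · linarith [hδ1 i, hδ3 (i + 1) i rfl]
  · have : {y : ℕ → ℝ | ∀ i ≤ I.sup id, y i ∈ Set.Ioc (z i - δ i) (z i + δ i)}
        = ⋂ i ∈ Set.Iic (I.sup id), (fun y : ℕ → ℝ => y i) ⁻¹' Set.Ioc (z i - δ i) (z i + δ i) := by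
      ext y
      simp
    rw [this, Filter.biInter_mem (Set.finite_Iic _)]
    intro i _
    exact (continuous_apply i).continuousAt (Ioc_mem_nhds (by linarith [hδ0 i])
      (by linarith [hδ0 i]))
  · intro y hy
    exact hvu fun i hi => hδv i hi (hy i (Finset.le_sup (f := id) hi))

/-! ### Interarrival times and the conclusion. -/

/-- If the increments of counting processes converge to those of a Poisson process, then the
interarrival times converge in distribution to independent exponential variables. -/
theorem tendstoInDistribution_interRequestTime {r : ℝ} (hr : 0 < r) {Ω : ℝ≥0 → Type*}
    [∀ x, MeasurableSpace (Ω x)] (P : (x : ℝ≥0) → Measure (Ω x)) [∀ x, IsProbabilityMeasure (P x)]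
    [IsProbabilityMeasure (expMeasure r)]
    (N : (x : ℝ≥0) → ℝ≥0 → Ω x → ℕ) (hmeas : ∀ x t, Measurable (N x t))
    (hzero : ∀ x ω, N x 0 ω = 0) (hmono : ∀ x ω, Monotone fun t => N x t ω)
    (hrc : ∀ x ω t, ContinuousWithinAt (fun s => N x s ω) (Set.Ici t) t)
    (hex : ∀ x, 0 < x → ∀ᵐ ω ∂(P x), ∀ k : ℕ, ∃ t : ℝ≥0, k ≤ N x t ω)
    (hlim : ∀ (l : ℕ) (t : Fin (l + 1) → ℝ≥0), Monotone t → ∀ n : Fin l → ℕ,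
      Tendsto (fun x => (P x).real
          {ω | ∀ i : Fin l, N x (t i.succ) ω = N x (t i.castSucc) ω + n i}) atTop
        (𝓝 (∏ i : Fin l, poissonMass (r * ((t i.succ : ℝ) - (t i.castSucc : ℝ))) (n i)))) :
    TendstoInDistribution (fun x (ω : Ω x) (k : ℕ) => interRequestTime (N x) k ω) atTop
      (fun z : ℕ → ℝ => z) P (Measure.infinitePi fun _ : ℕ => expMeasure r) := by
  set T : (x : ℝ≥0) → Ω x → ℕ → ℝ := fun x ω k => arrivalTime (N x) (k + 1) ω with hTdef
  set S : (ℕ → ℝ) → ℕ → ℝ := fun z k => ∑ j ∈ Finset.range (k + 1), z j with hSdef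
  have hTm : ∀ x, Measurable (T x) := fun x => measurable_pi_lambda _ fun k =>
    measurable_arrivalTime (hmeas x) (hmono x) (hrc x) (k + 1)
  have hSm : Measurable S := measurable_pi_lambda _ fun k =>
    Finset.measurable_sum _ fun j _ => measurable_pi_apply j
  have hT : TendstoInDistribution T atTop S P (Measure.infinitePi fun _ : ℕ => expMeasure r) := by
    refine ⟨fun x => (hTm x).aemeasurable, hSm.aemeasurable, ?_⟩
    refine isPiSystem_orderedBoxes.tendsto_probabilityMeasure_of_ae_nhds
      (fun s hs => measurableSet_of_mem_orderedBoxes hs)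
      (C := {z | 0 < z 0 ∧ ∀ i, z i < z (i + 1)}) ?_
      (fun u hu z hzu hz => exists_mem_orderedBoxes_subset hu hzu hz.1 hz.2) ?_
    · have hC : MeasurableSet {z : ℕ → ℝ | 0 < z 0 ∧ ∀ i, z i < z (i + 1)} := by
        have : {z : ℕ → ℝ | 0 < z 0 ∧ ∀ i, z i < z (i + 1)}
            = {z | 0 < z 0} ∩ ⋂ i, {z | z i < z (i + 1)} := by
          ext z
          simp
        rw [this]
        refine (measurableSet_lt measurable_const (measurable_pi_apply 0)).inter ?_
        exact MeasurableSet.iInter fun i =>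
          measurableSet_lt (measurable_pi_apply i) (measurable_pi_apply (i + 1))
      rw [ProbabilityMeasure.coe_mk]
      refine (ae_map_iff hSm.aemeasurable hC).2 ?_
      filter_upwards [ae_infinitePi_expMeasure_pos hr] with z hz
      refine ⟨by simpa [hSdef] using hz 0, fun i => ?_⟩
      simp only [hSdef]
      rw [Finset.sum_range_succ _ (i + 1)]
      linarith [hz (i + 1)]
    · intro s hs
      have hsm := measurableSet_of_mem_orderedBoxes hs
      obtain ⟨k, a, b, ha, hab, hba, rfl⟩ := hs
      have h := tendsto_measureReal_arrivalTime_mem_Ioc P N hmeas hzero hmono hrc hex hlim k ha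
        hab hba
      have hlaw := infinitePi_expMeasure_partialSum_mem_Ioc hr k ha hab hba
      have hval : 0 ≤ (∏ i ∈ Finset.range k, r * (b i - a i)) *
          (Real.exp (-(r * a k)) - Real.exp (-(r * b k))) :=
        ge_of_tendsto' h fun x => measureReal_nonneg
      rw [← NNReal.tendsto_coe]
      convert h using 2
      · exact map_measureReal_apply (hTm _) hsm
      · refine (map_measureReal_apply hSm hsm).trans ?_
        rw [Measure.real]
        exact (congrArg ENNReal.toReal hlaw).trans (ENNReal.toReal_ofReal hval)
  -- `D` inverts the partial sum map and is continuous because each coordinate depends on at most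
  -- two others, so the continuous mapping theorem transfers convergence to the gaps.
  set D : (ℕ → ℝ) → ℕ → ℝ := fun z k => z k - if k = 0 then 0 else z (k - 1) with hDdef
  have hD : Continuous D := by
    refine continuous_pi fun k => (continuous_apply k).sub ?_
    split_ifs
    · exact continuous_const
    · exact continuous_apply (k - 1)
  have hDT : (fun x (ω : Ω x) (k : ℕ) => interRequestTime (N x) k ω) = fun x => D ∘ T x := by
    funext x ω k
    rcases k with _ | k
    · simp [hDdef, hTdef, interRequestTime, arrivalTime_zero]
    · simp [hDdef, hTdef, interRequestTime]
  have hDS : (fun z : ℕ → ℝ => z) = D ∘ S := by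
    funext z k
    rcases k with _ | k
    · simp [hDdef, hSdef]
    · simp [hDdef, hSdef, Finset.sum_range_succ]
  rw [hDT, hDS]
  exact hT.continuous_comp hD

theorem tendsto_measureReal_increments {m : ℕ} {A : Matrix (Fin m) (Fin m) ℝ}
    {θ h : Fin m → ℝ} (hθ : ∀ j, 0 ≤ θ j) {r B H : ℝ} (hr : 0 ≤ r)
    (hh : A.mulVec h = fun j => θ j - r) (hB : ∀ j, |θ j - r| ≤ B) (hH : ∀ j, |h j| ≤ H)
    {Ω : ℝ≥0 → Type*} [∀ x, MeasurableSpace (Ω x)]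
    (P : (x : ℝ≥0) → Measure (Ω x)) [∀ x, IsProbabilityMeasure (P x)]
    (J : (x : ℝ≥0) → ℝ≥0 → Ω x → Fin m) (N : (x : ℝ≥0) → ℝ≥0 → Ω x → ℕ)
    (hN : ∀ x : ℝ≥0, IsMMPP ((x : ℝ) • A) θ (P x) (J x) (N x))
    (l : ℕ) (t : Fin (l + 1) → ℝ≥0) (ht : Monotone t) (n : Fin l → ℕ) :
    Tendsto (fun x => (P x).real
        {ω | ∀ i : Fin l, N x (t i.succ) ω = N x (t i.castSucc) ω + n i}) atTop
      (𝓝 (∏ i : Fin l, poissonMass (r * ((t i.succ : ℝ) - (t i.castSucc : ℝ))) (n i))) := by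
  have hti : ∀ i : Fin l, t i.castSucc ≤ t i.succ := fun i => ht (Fin.castSucc_lt_succ).le
  rw [tendsto_iff_dist_tendsto_zero]
  have hbound : Tendsto (fun x : ℝ≥0 => ∑ i : Fin l,
      √(4 * B * H / (x : ℝ) * ((t i.succ : ℝ) - t i.castSucc))) atTop (𝓝 0) := by
    have hx : Tendsto (fun x : ℝ≥0 => (x : ℝ)) atTop atTop := NNReal.tendsto_coe_atTop.2 tendsto_id
    have := tendsto_finsetSum (Finset.univ : Finset (Fin l)) fun i _ =>
      (((tendsto_const_nhds (x := 4 * B * H)).div_atTop hx).mul_const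
        ((t i.succ : ℝ) - t i.castSucc)).sqrt
    simpa using this
  refine squeeze_zero' (Eventually.of_forall fun x => dist_nonneg) ?_ hbound
  filter_upwards [eventually_gt_atTop 0] with x hx
  have hx' : (0 : ℝ) < x := NNReal.coe_pos.2 hx
  rw [(hN x).measureReal_increments ht n, Real.dist_eq]
  refine (abs_integral_prod_poissonMass_sub_le Finset.univ
    (fun i ω => cumIntensity_nonneg hθ (hti i) ω)
    (fun i => mul_nonneg hr (sub_nonneg.2 (NNReal.coe_le_coe.2 (hti i))))
    (fun i => (hN x).ctmc.memLp_cumIntensity_sub θ r (hti i)) n).trans ?_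
  exact Finset.sum_le_sum fun i _ => Real.sqrt_le_sqrt
    ((hN x).ctmc.integral_sq_cumIntensity_sub_le hx' hh hB hH (hti i))

theorem mainTheorem2 {m : ℕ} (A : Matrix (Fin m) (Fin m) ℝ) (hA : IsGenerator A)
    (θ : Fin m → ℝ) (hθ : ∀ j, 0 ≤ θ j)
    (p : Fin m → ℝ) (hp : IsStationaryDist A p) (hp_unique : ∀ q, IsStationaryDist A q → q = p)
    {Ω : ℝ≥0 → Type*} [∀ x, MeasurableSpace (Ω x)]
    (P : (x : ℝ≥0) → Measure (Ω x)) [∀ x, IsProbabilityMeasure (P x)]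
    (J : (x : ℝ≥0) → ℝ≥0 → Ω x → Fin m) (N : (x : ℝ≥0) → ℝ≥0 → Ω x → ℕ)
    (hN : ∀ x : ℝ≥0, IsMMPP ((x : ℝ) • A) θ (P x) (J x) (N x)) :
    -- the counts over disjoint intervals converge to those of a Poisson process
    (∀ (l : ℕ) (t : Fin (l + 1) → ℝ≥0), Monotone t → ∀ n : Fin l → ℕ,
      Tendsto
        (fun x => (P x).real
          {ω | ∀ i : Fin l, N x (t i.succ) ω = N x (t i.castSucc) ω + n i})
        atTop
        (𝓝 (∏ i : Fin l,
          poissonMass ((∑ j, θ j * p j) * ((t i.succ : ℝ) - (t i.castSucc : ℝ))) (n i)))) ∧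
    -- if the limiting rate is positive, all inter-request times are well defined and their
    -- sequence converges in distribution to an i.i.d. sequence of exponential variables
    (∀ h : 0 < ∑ j, θ j * p j,
      (∀ x, 0 < x → ∀ᵐ ω ∂(P x), ∀ k : ℕ, ∃ t : ℝ≥0, k ≤ N x t ω) ∧
      haveI : IsProbabilityMeasure (expMeasure (∑ j, θ j * p j)) :=
        isProbabilityMeasure_expMeasure h
      TendstoInDistribution
        (fun x (ω : Ω x) (k : ℕ) => interRequestTime (N x) k ω) atTop
        (fun z : ℕ → ℝ => z) P
        (Measure.infinitePi fun _ : ℕ => expMeasure (∑ j, θ j * p j))) := by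
  set r : ℝ := ∑ j, θ j * p j with hrdef
  have hr : 0 ≤ r := Finset.sum_nonneg fun j _ => mul_nonneg (hθ j) (hp.nonneg j)
  -- `θ - r` has stationary mean zero by the choice of `r`.
  obtain ⟨h, hh⟩ := hA.exists_mulVec_eq hp_unique (g := fun j => θ j - r) (by
    simp only [mul_sub, Finset.sum_sub_distrib, ← Finset.sum_mul, hp.sum_eq_one, one_mul]
    simp [hrdef, mul_comm])
  have hle : ∀ (f : Fin m → ℝ) (j : Fin m), |f j| ≤ ∑ i, |f i| := fun f j =>
    Finset.single_le_sum (f := fun j => |f j|) (fun _ _ => abs_nonneg _) (Finset.mem_univ j)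
  have hB := hle fun j => θ j - r
  have hlim := tendsto_measureReal_increments hθ hr hh hB (hle h) P J N hN
  refine ⟨hlim, fun hr0 => ?_⟩
  have hex : ∀ x, 0 < x → ∀ᵐ ω ∂(P x), ∀ k : ℕ, ∃ t : ℝ≥0, k ≤ N x t ω := by
    intro x hx
    refine (hN x).ae_forall_exists_le hθ hr0
      (C := 4 * (∑ i, |θ i - r|) * (∑ i, |h i|) / (x : ℝ)) fun t => ?_
    have := (hN x).ctmc.integral_sq_cumIntensity_sub_le (NNReal.coe_pos.2 hx) hh hB (hle h)
      (zero_le : (0 : ℝ≥0) ≤ t)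
    simpa only [NNReal.coe_zero, sub_zero] using this
  refine ⟨hex, ?_⟩
  have := isProbabilityMeasure_expMeasure hr0
  exact tendstoInDistribution_interRequestTime hr0 P N (fun x => (hN x).measurable)
    (fun x => (hN x).zero) (fun x => (hN x).mono) (fun x => (hN x).rightCont) hex hlim
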